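/- **Setting.** Let $\mathsf X$ be a Polish space with its Borel $\sigma$-algebra, $\nu$ a $\sigma$-finite measure on $\mathsf X$, $\chi$ a probability measure on $\mathsf X$, $q(x,x')\ge 0$ a jointly measurable transition density w.r.t. $\nu$ (so $\int q(x,x')\,\nu(dx')=1$), and $Q(x,dx')=q(x,x')\,\nu(dx')$. Let $g_t:\mathsf X\to[0,\infty)$, $t\ge 0$, be measurable (the likelihoods of the fixed observations). Let $1\le s\le T$ be integers and assume $Z_T=\int\cdots\int\chi(dx_0)g_0(x_0)\prod_{t=1}^TQ(x_{t-1},dx_t)g_t(x_t)>0$. For $h:\mathsf X^{T-s+1}\to\mathbb R$ measurable, the smoothing distribution is $$\phi_{s:T|T}(h)=Z_T^{-1}\int\cdots\int h(x_{s:T})\,\chi(dx_0)g_0(x_0)\prod_{t=1}^TQ(x_{t-1},dx_t)g_t(x_t),$$ and $\operatorname{osc}(h)=\sup_{x,x'}|h(x)-h(x')|\in[0,\infty]$. **Particle filter.** Let $\rho_0$ be a probability measure with $\chi\ll\rho_0$ and, for $t\ge1$, let $p_t(x,x')\ge0$ be a jointly measurable transition density w.r.t. $\nu$ and $\vartheta_t:\mathsf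 X\to[0,\infty)$ measurable. Set $\omega_0(x)=\frac{d\chi}{d\rho_0}(x)g_0(x)$ and $\omega_t(x,x')=\frac{q(x,x')g_t(x')}{\vartheta_t(x)p_t(x,x')}$ for $t\ge1$ (with $0/0=0$ and $a/0=\infty$ for $a>0$). For $N\ge1$, let $\xi_0^1,\dots,\xi_0^N$ be i.i.d. with law $\rho_0$ and $\omega_0^i=\omega_0(\xi_0^i)$. For $t\ge1$, given the weighted particles $(\xi_u^i,\omega_u^i)_{u<t,\,i\le N}$, the pairs $(I_t^i,\xi_t^i)$, $1\le i\le N$, are i.i.d. on $\{1,\dots,N\}\times\mathsf X$ with density proportional to $(j,x)\mapsto\omega_{t-1}^j\vartheta_t(\xi_{t-1}^j)p_t(\xi_{t-1}^j,x)$ w.r.t. (counting measure)$\,\otimes\,\nu$, and $\omega_t^i=\omega_t(\xi_{t-1}^{I_t^i},\xi_t^i)$. Here and below, whenever $N$ nonnegative weights are normalised to a probability vector and they all vanish, the uniform probability vector is used. **Backward pass.** Let $W_u(j,i)=\dfrac{\omega_u^iq(\xi_u^i,\xi_{u+1}^j)}{\sum_{\ell=1}^N\omega_u^\ell q(\xi_u^\ell,\xi_{u+1}^j)}$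 and, for $i_{s:T}\in\{1,\dots,N\}^{T-s+1}$, $$\pi(i_{s:T})=\frac{\omega_T^{i_T}}{\sum_{\ell}\omega_T^\ell}\prod_{u=s}^{T-1}W_u(i_{u+1},i_u).$$ The FFBSm estimator is $\hat\phi_{s:T|T}(h)=\sum_{i_{s:T}}\pi(i_{s:T})\,h(\xi_s^{i_s},\dots,\xi_T^{i_T})$. The FFBSi estimator is $\tilde\phi_{s:T|T}(h)=N^{-1}\sum_{\ell=1}^Nh(\xi_s^{J_s^\ell},\dots,\xi_T^{J_T^\ell})$, where, given all particles and weights up to time $T$, the index paths $J^1_{s:T},\dots,J^N_{s:T}$ are i.i.d. with law $\pi$. **Theorem.** Assume (A1) $\sup_{0\le t\le T}\sup_{x}g_t(x)<\infty$; (A2) $\sup_{1\le t\le T}\sup_x\vartheta_t(x)<\infty$, $\omega_0$ is bounded $\rho_0$-almost everywhere, and $\sup_{1\le t\le T}\sup_{x,x'}\omega_t(x,x')<\infty$. Then there exist constants $0<B,C<\infty$ such that for all $N\ge1$, all $\varepsilon>0$ and all measurable $h:\mathsf X^{T-s+1}\to\mathbb R$, $$\mathbb P\big[|\hat\phi_{s:T|T}(h)-\phi_{s:T|T}(h)|\ge\varepsilon\big]\le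 B\,e^{-CN\varepsilon^2/\operatorname{osc}(h)^2},\qquad \mathbb P\big[|\tilde\phi_{s:T|T}(h)-\phi_{s:T|T}(h)|\ge\varepsilon\big]\le B\,e^{-CN\varepsilon^2/\operatorname{osc}(h)^2}.$$ The right-hand side is read as $0$ if $\operatorname{osc}(h)=0$ and as $B$ if $\operatorname{osc}(h)=\infty$ (in which case $\phi_{s:T|T}(h)$ is set to $0$ if $h$ is not integrable). -/

import Mathlib

open MeasureTheory ProbabilityTheory
open scoped NNReal ENNReal

noncomputable section

namespace FFBS

/-! ### Generic constructions -/

section Generic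

variable {α β S : Type*} [MeasurableSpace α] [MeasurableSpace β] [MeasurableSpace S]

/-- The oscillation `sup_{x,x'} |h x - h x'|`, as an element of `[0, ∞]`. -/
def osc {γ : Type*} (h : γ → ℝ) : ℝ≥0∞ := ⨆ (x : γ) (x' : γ), ENNReal.ofReal |h x - h x'|

/-- Normalised weights `w i / ∑ ℓ, w ℓ`. If all the weights vanish (the quotient is then `0 / 0`),
the uniform distribution is used. -/
def normalize {N : ℕ} (w : Fin N → ℝ≥0) (i : Fin N) : ℝ≥0 :=
  if ∑ l, w l = 0 then 1 / (N : ℝ≥0) else w i / ∑ l, w l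

theorem sum_normalize {N : ℕ} [NeZero N] (w : Fin N → ℝ≥0) : ∑ i, normalize w i = 1 := by
  have hN : (N : ℝ≥0) ≠ 0 := by exact_mod_cast NeZero.ne N
  unfold normalize
  by_cases h : ∑ l, w l = 0
  · simp [h, hN]
  · simp only [if_neg h]
    rw [← Finset.sum_div, div_self h]

theorem measurable_normalize {N : ℕ} {w : α → Fin N → ℝ≥0} (hw : ∀ i, Measurable fun a => w a i)
    (i : Fin N) : Measurable fun a => normalize (w a) i := by
  have hs : Measurable fun a => ∑ l, w a l := Finset.measurable_sum _ fun l _ => hw l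
  exact Measurable.ite (hs (measurableSet_singleton 0)) measurable_const ((hw i).div hs)

/-- Mixture `a ↦ ∑ i, w a i • κ i a` of finitely many kernels. -/
def mixture {ι : Type*} [Fintype ι] (w : α → ι → ℝ≥0) (hw : ∀ i, Measurable fun a => w a i)
    (κ : ι → Kernel α β) : Kernel α β where
  toFun a := ∑ i, (w a i : ℝ≥0∞) • κ i a
  measurable' := by
    refine Measure.measurable_of_measurable_coe _ fun s hs => ?_
    simp only [Measure.coe_finsetSum, Finset.sum_apply, Measure.smul_apply, smul_eq_mul]
    exact Finset.measurable_sum _ fun i _ =>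
      (hw i).coe_nnreal_ennreal.mul ((κ i).measurable_coe hs)

theorem isMarkovKernel_mixture {ι : Type*} [Fintype ι] (w : α → ι → ℝ≥0)
    (hw : ∀ i, Measurable fun a => w a i) (κ : ι → Kernel α β) [∀ i, IsMarkovKernel (κ i)]
    (h1 : ∀ a, ∑ i, w a i = 1) : IsMarkovKernel (mixture w hw κ) := by
  refine ⟨fun a => ⟨?_⟩⟩
  have := congrArg (fun r : ℝ≥0 => (r : ℝ≥0∞)) (h1 a)
  simpa [mixture, Measure.coe_finsetSum, Finset.sum_apply] using this

/-- `N` independent draws from `κ a`. -/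
def iid (κ : Kernel α β) [IsMarkovKernel κ] (N : ℕ) : Kernel α (Fin N → β) where
  toFun a := Measure.pi fun _ : Fin N => κ a
  measurable' := by
    refine Measurable.measure_of_isPiSystem_of_isProbabilityMeasure
      generateFrom_pi.symm isPiSystem_pi ?_
    rintro _ ⟨s, hs, rfl⟩
    simp only [Set.mem_univ, Set.mem_pi, Set.mem_ofPred_eq, forall_const] at hs
    simp only [Measure.pi_pi]
    exact Finset.measurable_prod _ fun i _ => κ.measurable_coe (hs i)

instance (κ : Kernel α β) [IsMarkovKernel κ] (N : ℕ) : IsMarkovKernel (iid κ N) :=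
  ⟨fun a => by change IsProbabilityMeasure (Measure.pi fun _ : Fin N => κ a); infer_instance⟩

/-- Law of `(X_0, …, X_t)` for the Markov chain with `X_0 ∼ μ` and `X_{u+1} | X_{0:u} ∼ κ_{u+1}(X_u, ·)`.
A path `(X_0, …, X_t)` is stored as the sequence `(X_0, …, X_t, X_0, X_0, …)`; only the
coordinates up to `t` are ever used. -/
def chainLaw (μ : Measure S) (κ : ℕ → Kernel S S) : ℕ → Measure (ℕ → S)
  | 0 => μ.map fun x _ => x
  | t + 1 => (chainLaw μ κ t ⊗ₘ (κ (t + 1)).comap (fun x : ℕ → S => x t) (measurable_pi_apply t)).map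
      fun z => Function.update z.1 (t + 1) z.2

theorem measurable_extend (t : ℕ) :
    Measurable fun z : (ℕ → S) × S => Function.update z.1 (t + 1) z.2 := by
  refine measurable_pi_lambda _ fun n => ?_
  by_cases h : n = t + 1
  · subst h; simpa using measurable_snd
  · simpa [Function.update_of_ne h] using measurable_fst.eval

instance (μ : Measure S) [IsProbabilityMeasure μ] (κ : ℕ → Kernel S S) [∀ t, IsMarkovKernel (κ t)]
    (t : ℕ) : IsProbabilityMeasure (chainLaw μ κ t) := by
  induction t with
  | zero =>
    exact Measure.isProbabilityMeasure_map
      (measurable_pi_lambda _ fun _ => measurable_id).aemeasurable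
  | succ t ih => exact Measure.isProbabilityMeasure_map (measurable_extend t).aemeasurable

/-- The Markov kernel with transition density `f` with respect to `ν`. -/
def densityKernel (ν : Measure S) [SigmaFinite ν] (f : S → S → ℝ≥0) : Kernel S S :=
  (Kernel.const S ν).withDensity fun x x' => (f x x' : ℝ≥0∞)

theorem isMarkovKernel_densityKernel (ν : Measure S) [SigmaFinite ν] {f : S → S → ℝ≥0}
    (hf : Measurable (Function.uncurry f)) (h1 : ∀ x, ∫⁻ x', (f x x' : ℝ≥0∞) ∂ν = 1) :
    IsMarkovKernel (densityKernel ν f) := by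
  refine ⟨fun x => ⟨?_⟩⟩
  have hm : Measurable (Function.uncurry fun x x' => (f x x' : ℝ≥0∞)) := hf.coe_nnreal_ennreal
  rw [densityKernel, Kernel.withDensity_apply _ hm, withDensity_apply _ MeasurableSet.univ]
  simpa using h1 x

end Generic

/-! ### State space model and smoothing distribution -/

/-- A fully dominated state space model with fixed observations: reference measure `ν`, initial
distribution `χ`, transition density `q` with respect to `ν`, and `g t x` is the likelihood of the
observation at time `t` in state `x`. -/
structure StateSpaceModel (X : Type*) [MeasurableSpace X] where
  ν : Measure X
  χ : Measure X
  q : X → X → ℝ≥0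
  g : ℕ → X → ℝ≥0
  sigmaFinite_ν : SigmaFinite ν
  isProbabilityMeasure_χ : IsProbabilityMeasure χ
  measurable_q : Measurable (Function.uncurry q)
  lintegral_q : ∀ x, ∫⁻ x', (q x x' : ℝ≥0∞) ∂ν = 1
  measurable_g : ∀ t, Measurable (g t)

attribute [instance] StateSpaceModel.sigmaFinite_ν StateSpaceModel.isProbabilityMeasure_χ

variable {X : Type*} [MeasurableSpace X]

/-- The segment `x_{s:T}` of a path. -/
def segment (s T : ℕ) (x : ℕ → X) : Fin (T - s + 1) → X := fun k => x (s + k)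

namespace StateSpaceModel

variable (M : StateSpaceModel X)

/-- The transition kernel `Q`. -/
def Q : Kernel X X := densityKernel M.ν M.q

instance : IsMarkovKernel M.Q := isMarkovKernel_densityKernel M.ν M.measurable_q M.lintegral_q

/-- The prior law of the states `X_{0:T}`. -/
def priorLaw (T : ℕ) : Measure (ℕ → X) := chainLaw M.χ (fun _ => M.Q) T

/-- The likelihood `∏_{t=0}^T g_t(x_t)` of the observations given the states. -/
def likelihood (T : ℕ) (x : ℕ → X) : ℝ≥0∞ := ∏ t ∈ Finset.range (T + 1), (M.g t (x t) : ℝ≥0∞)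

/-- The likelihood of the observations, i.e. the normalising constant of the posterior. -/
def evidence (T : ℕ) : ℝ≥0∞ := ∫⁻ x, M.likelihood T x ∂M.priorLaw T

/-- The joint smoothing distribution `φ_{s:T|T}`: the posterior law of `X_{s:T}` given all the
observations up to time `T`. -/
def smoothing (s T : ℕ) : Measure (Fin (T - s + 1) → X) :=
  ((M.evidence T)⁻¹ • (M.priorLaw T).withDensity (M.likelihood T)).map (segment s T)

end StateSpaceModel

/-! ### Auxiliary particle filter -/

/-- Tuning of the auxiliary particle filter: initial proposal `ρ₀` dominating `χ`, and for `t ≥ 1` the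
proposal transition density `p t` with respect to `ν` and the adjustment multiplier `ϑ t`. -/
structure Proposal (M : StateSpaceModel X) where
  ρ₀ : Measure X
  p : ℕ → X → X → ℝ≥0
  ϑ : ℕ → X → ℝ≥0
  isProbabilityMeasure_ρ₀ : IsProbabilityMeasure ρ₀
  absolutelyContinuous : M.χ ≪ ρ₀
  measurable_p : ∀ t, Measurable (Function.uncurry (p t))
  lintegral_p : ∀ t x, ∫⁻ x', (p t x x' : ℝ≥0∞) ∂M.ν = 1
  measurable_ϑ : ∀ t, Measurable (ϑ t)

attribute [instance] Proposal.isProbabilityMeasure_ρ₀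

/-- A cloud of `N` weighted particles `(ξ^i, ω^i)`. -/
abbrev Cloud (N : ℕ) (X : Type*) := Fin N → X × ℝ≥0

namespace Proposal

variable {M : StateSpaceModel X} (A : Proposal M)

/-- The initial importance weight function `(dχ/dρ₀) g_0`. -/
def weight₀ (x : X) : ℝ≥0∞ := M.χ.rnDeriv A.ρ₀ x * M.g 0 x

/-- The importance weight function `q(x,x') g_t(x') / (ϑ_t(x) p_t(x,x'))`, with values in `[0, ∞]`:
a positive numerator over a zero denominator gives `∞`, and `0 / 0 = 0`. -/
def weight (t : ℕ) (x x' : X) : ℝ≥0∞ :=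
  ((M.q x x' : ℝ≥0∞) * M.g t x') / ((A.ϑ t x : ℝ≥0∞) * A.p t x x')

theorem measurable_weight₀ : Measurable A.weight₀ :=
  (Measure.measurable_rnDeriv _ _).mul (M.measurable_g 0).coe_nnreal_ennreal

theorem measurable_weight (t : ℕ) : Measurable (Function.uncurry (A.weight t)) := by
  have h1 : Measurable fun z : X × X => (M.q z.1 z.2 : ℝ≥0∞) := M.measurable_q.coe_nnreal_ennreal
  have h2 : Measurable fun z : X × X => (M.g t z.2 : ℝ≥0∞) :=
    ((M.measurable_g t).comp measurable_snd).coe_nnreal_ennreal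
  have h3 : Measurable fun z : X × X => (A.ϑ t z.1 : ℝ≥0∞) :=
    ((A.measurable_ϑ t).comp measurable_fst).coe_nnreal_ennreal
  have h4 : Measurable fun z : X × X => (A.p t z.1 z.2 : ℝ≥0∞) :=
    (A.measurable_p t).coe_nnreal_ennreal
  exact (h1.mul h2).div (h3.mul h4)

/-- The proposal kernel at time `t`. -/
def P (t : ℕ) : Kernel X X := densityKernel M.ν (A.p t)

instance (t : ℕ) : IsMarkovKernel (A.P t) :=
  isMarkovKernel_densityKernel M.ν (A.measurable_p t) (A.lintegral_p t)

/-- Law of the weighted particle `(ξ, ω_0(ξ))` with `ξ ∼ ρ₀`. -/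
def initParticle : Measure (X × ℝ≥0) := A.ρ₀.map fun x => (x, (A.weight₀ x).toNNReal)

theorem measurable_initParticle : Measurable fun x : X => (x, (A.weight₀ x).toNNReal) :=
  measurable_id.prodMk A.measurable_weight₀.ennreal_toNNReal

instance : IsProbabilityMeasure A.initParticle :=
  Measure.isProbabilityMeasure_map A.measurable_initParticle.aemeasurable

/-- Law of the weighted particle `(ξ', ω_t(x, ξ'))` with `ξ' ∼ p_t(x, ·)`. -/
def move (t : ℕ) : Kernel X (X × ℝ≥0) :=
  (Kernel.id ×ₖ A.P t).map fun z => (z.2, (A.weight t z.1 z.2).toNNReal)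

theorem measurable_move (t : ℕ) :
    Measurable fun z : X × X => (z.2, (A.weight t z.1 z.2).toNNReal) :=
  measurable_snd.prodMk (A.measurable_weight t).ennreal_toNNReal

instance (t : ℕ) : IsMarkovKernel (A.move t) :=
  Kernel.IsMarkovKernel.map _ (A.measurable_move t)

/-- Probability `∝ ω^i ϑ_t(ξ^i)` that a new particle descends from the particle `i`. -/
def ancestorProb {N : ℕ} (t : ℕ) (c : Cloud N X) : Fin N → ℝ≥0 :=
  normalize fun i => (c i).2 * A.ϑ t (c i).1

theorem measurable_ancestorProb {N : ℕ} (t : ℕ) (i : Fin N) :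
    Measurable fun c : Cloud N X => A.ancestorProb t c i :=
  measurable_normalize (fun l => (measurable_pi_apply l).snd.mul
    ((A.measurable_ϑ t).comp (measurable_pi_apply l).fst)) i

/-- Law of one new weighted particle given the previous cloud: the pair (ancestor index, position) is
drawn from the density `∝ ω^i ϑ_t(ξ^i) p_t(ξ^i, x)`, and the position is kept together with its
importance weight `ω_t(ξ^i, x)`. -/
def newParticle (N : ℕ) (t : ℕ) : Kernel (Cloud N X) (X × ℝ≥0) :=
  mixture (A.ancestorProb t) (A.measurable_ancestorProb t) fun i : Fin N =>
    (A.move t).comap (fun c : Cloud N X => (c i).1) (measurable_pi_apply i).fst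

instance (N : ℕ) [NeZero N] (t : ℕ) : IsMarkovKernel (A.newParticle N t) :=
  isMarkovKernel_mixture _ _ _ fun _ => sum_normalize _

/-- Joint law of the particle clouds at times `0, …, T`: the initial particles are i.i.d., and given the
past the particles at time `t` are i.i.d. -/
def filterLaw (N : ℕ) [NeZero N] (T : ℕ) : Measure (ℕ → Cloud N X) :=
  chainLaw (Measure.pi fun _ : Fin N => A.initParticle) (fun t => iid (A.newParticle N t) N) T

instance (N : ℕ) [NeZero N] (T : ℕ) : IsProbabilityMeasure (A.filterLaw N T) := by
  unfold filterLaw; infer_instance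

end Proposal

/-! ### Backward pass: FFBSm and FFBSi -/

/-- The particle path `(ξ_s^{i_s}, …, ξ_T^{i_T})` with index path `i_{s:T}`. -/
def particlePath (s T : ℕ) {N : ℕ} (c : ℕ → Cloud N X) (i : Fin (T - s + 1) → Fin N) :
    Fin (T - s + 1) → X := fun k => (c (s + k) (i k)).1

/-- The FFBSi estimator of `φ_{s:T|T}(h)`, from `N` index paths `J^1, …, J^N`. -/
def ffbsi {N : ℕ} (s T : ℕ) (h : (Fin (T - s + 1) → X) → ℝ) (c : ℕ → Cloud N X)
    (J : Fin N → Fin (T - s + 1) → Fin N) : ℝ :=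
  (N : ℝ)⁻¹ * ∑ l, h (particlePath s T c (J l))

namespace StateSpaceModel

variable (M : StateSpaceModel X) {N : ℕ}

/-- Backward transition probability from the particle `j` at time `u + 1` to the particle `i` at time
`u`, that is `ω_u^i q(ξ_u^i, ξ_{u+1}^j) / ∑ ℓ, ω_u^ℓ q(ξ_u^ℓ, ξ_{u+1}^j)`. -/
def backward (c : ℕ → Cloud N X) (u : ℕ) (j i : Fin N) : ℝ≥0 :=
  normalize (fun l => (c u l).2 * M.q (c u l).1 (c (u + 1) j).1) i

/-- Probability of the index path `i_{s:T}` under the backward Markov chain started at time `T` from the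
normalised filtering weights; `i k` is the index at time `s + k`. -/
def indexProb (s T : ℕ) (c : ℕ → Cloud N X) (i : Fin (T - s + 1) → Fin N) : ℝ≥0 :=
  normalize (fun l => (c T l).2) (i (Fin.last (T - s))) *
    ∏ k : Fin (T - s), M.backward c (s + k) (i k.succ) (i k.castSucc)

/-- The FFBSm estimator of `φ_{s:T|T}(h)`. -/
def ffbsm (s T : ℕ) (h : (Fin (T - s + 1) → X) → ℝ) (c : ℕ → Cloud N X) : ℝ :=
  ∑ i : Fin (T - s + 1) → Fin N, (M.indexProb s T c i : ℝ) * h (particlePath s T c i)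

theorem measurable_indexProb (s T : ℕ) (i : Fin (T - s + 1) → Fin N) :
    Measurable fun c : ℕ → Cloud N X => M.indexProb s T c i := by
  have hc : ∀ (u : ℕ) (l : Fin N), Measurable fun c : ℕ → Cloud N X => c u l :=
    fun u l => (measurable_pi_apply l).comp (measurable_pi_apply u)
  refine (measurable_normalize (fun l => (hc T l).snd) _).mul
    (Finset.measurable_prod _ fun k _ => measurable_normalize (fun l => ?_) _)
  exact (hc _ l).snd.mul (M.measurable_q.comp ((hc _ l).fst.prodMk (hc _ _).fst))

theorem sum_indexProb [NeZero N] (s T : ℕ) (c : ℕ → Cloud N X) :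
    ∑ i, M.indexProb s T c i = 1 := by
  suffices H : ∀ (n : ℕ) (w : ℕ → Fin N → Fin N → ℝ≥0) (f : Fin N → ℝ≥0),
      (∀ u j, ∑ i, w u j i = 1) → (∑ i, f i = 1) →
      ∑ i : Fin (n + 1) → Fin N, f (i (Fin.last n)) * ∏ k : Fin n, w k (i k.succ) (i k.castSucc)
        = 1 from
    H (T - s) (fun k => M.backward c (s + k)) _ (fun _ _ => sum_normalize _) (sum_normalize _)
  intro n
  induction n with
  | zero =>
    intro w f _ hf
    rw [← hf, ← (Equiv.funUnique (Fin 1) (Fin N)).sum_comp]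
    simp
  | succ n ih =>
    intro w f hw hf
    rw [← (Fin.consEquiv fun _ => Fin N).sum_comp, Fintype.sum_prod_type_right]
    rw [← ih (fun u => w (u + 1)) f (fun u j => hw _ j) hf]
    refine Finset.sum_congr rfl fun y _ => ?_
    rw [← mul_one (f _ * _), ← hw 0 (y 0), Finset.mul_sum]
    refine Finset.sum_congr rfl fun x _ => ?_
    simp [Fin.prod_univ_succ, ← Fin.succ_last]
    ring

/-- Law of one backward index path given the particle clouds. -/
def indexKernel (N : ℕ) (s T : ℕ) : Kernel (ℕ → Cloud N X) (Fin (T - s + 1) → Fin N) :=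
  mixture (M.indexProb s T) (M.measurable_indexProb s T) fun i =>
    Kernel.const _ (Measure.dirac i)

instance (N : ℕ) [NeZero N] (s T : ℕ) :
    IsMarkovKernel (M.indexKernel N s T) :=
  isMarkovKernel_mixture _ _ _ (M.sum_indexProb s T)

end StateSpaceModel

/-- Joint law of the particle clouds of the filter and, conditionally on them, of `N` independent
backward index paths `J^1_{s:T}, …, J^N_{s:T}`. -/
def Proposal.ffbsLaw {M : StateSpaceModel X} (A : Proposal M) (N : ℕ) [NeZero N] (s T : ℕ) :
    Measure ((ℕ → Cloud N X) × (Fin N → Fin (T - s + 1) → Fin N)) :=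
  A.filterLaw N T ⊗ₘ iid (M.indexKernel N s T) N

instance {M : StateSpaceModel X} (A : Proposal M) (N : ℕ) [NeZero N] (s T : ℕ) :
    IsProbabilityMeasure (A.ffbsLaw N s T) := by
  unfold Proposal.ffbsLaw; infer_instance

/-! ### Assumptions -/

/-- The likelihoods are bounded up to the horizon `T`. -/
def BoundedLikelihood (M : StateSpaceModel X) (T : ℕ) : Prop :=
  ∃ b : ℝ≥0, ∀ t ≤ T, ∀ x, M.g t x ≤ b

/-- The adjustment multipliers and the importance weight functions are bounded up to the horizon `T`
(`dχ/dρ₀` being defined only up to `ρ₀`-null sets, the bound at time `0` is `ρ₀`-almost everywhere). -/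
def BoundedWeights {M : StateSpaceModel X} (A : Proposal M) (T : ℕ) : Prop :=
  ∃ b : ℝ≥0, (∀ t, 1 ≤ t → t ≤ T → ∀ x, A.ϑ t x ≤ b) ∧
    (∀ᵐ x ∂A.ρ₀, A.weight₀ x ≤ b) ∧
    ∀ t, 1 ≤ t → t ≤ T → ∀ x x', A.weight t x x' ≤ b

/-- The right-hand side `B exp(-C N ε² / osc(h)²)`, with `exp(-∞) = 0` if `h` is constant and
`exp(0) = 1` if `h` has infinite oscillation. -/
def hoeffdingBound {γ : Type*} (B C : ℝ) (N : ℕ) (ε : ℝ) (h : γ → ℝ) : ℝ≥0∞ :=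
  ENNReal.ofReal B *
    EReal.exp (-((ENNReal.ofReal (C * N * ε ^ 2) / osc h ^ 2 : ℝ≥0∞) : EReal))

end FFBS

end

/-! Fix the smoothing mean φ of h and set f(x) = h(x_{s:T}) - φ, a bounded functional of the whole
path. At each time t ≤ T, `average T t f` is an unnormalised estimator of the posterior integral of
f: each particle has its past averaged under the backward chain (`retro`) and its future integrated
against the likelihoods (`lookahead`), and it carries its importance weight. At time T the quotient
of the averages of f and 1 is the FFBSm estimator of h minus φ (`ffbsm_mul_average`). At time 0 the
mean score of f is the evidence times the smoothing mean of f, that is 0.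

The heart is `adjust_mul_integral_score`. Given the clouds up to time t, the mean score of a new
particle, times a factor Θ that does not depend on f, equals the average at time t. Indeed ϑ p ω = q
g turns the proposal mixture into ∑ ω^i q(ξ^i, y) g(y), whose sum of ω^i q(ξ^i, y) is exactly the
denominator of the backward weights, so the two cancel. Hence, if r is the quotient at time t, the
score of f - r has conditional mean zero at time t + 1.

Given the past the new particles are i.i.d. with bounded scores, so Hoeffding's inequality shows
that the quotient drifts by less than η = ε/(T+1) per step, outside an event of exponentially small
probability, while the denominator stays above a deterministic level (`pi_goodEvent_compl_le`).
Induction over time gives FFBSm (`filterLaw_goodEvent_compl_le`). FFBSi adds one more conditional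
Hoeffding bound, for the i.i.d. index paths. -/

noncomputable section

namespace FFBS

/-! ### Concentration of sample means, conditioning, mixtures and normalised weights -/

section Concentration

variable {α β S : Type*} [MeasurableSpace α] [MeasurableSpace β] [MeasurableSpace S]

/-- By Hoeffding's lemma each centred term is sub-Gaussian with variance proxy m², and independence
adds the proxies. The bound on ψ is only almost sure because the initial weights are bounded only
almost everywhere. -/
theorem pi_sampleMean_sub_ge_le (p : Measure β) [IsProbabilityMeasure p] (N : ℕ) [NeZero N]
    {ψ : β → ℝ} (hψ : Measurable ψ) {m : ℝ} (hm : 0 < m) (hb : ∀ᵐ y ∂p, |ψ y| ≤ m)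
    {δ : ℝ} (hδ : 0 ≤ δ) :
    (Measure.pi fun _ : Fin N => p).real
        {y | δ ≤ (N : ℝ)⁻¹ * ∑ l, ψ (y l) - ∫ x, ψ x ∂p}
      ≤ Real.exp (-(N * δ ^ 2 / (2 * m ^ 2))) := by
  have hN : (0 : ℝ) < N := by exact_mod_cast Nat.pos_of_ne_zero (NeZero.ne N)
  have hsub := hasSubgaussianMGF_of_mem_Icc (μ := p) (a := -m) (b := m) hψ.aemeasurable
    (hb.mono fun y hy => abs_le.1 hy)
  have hmeas : Measurable fun x => ψ x - ∫ x, ψ x ∂p := hψ.sub_const _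
  have hind : iIndepFun (fun (l : Fin N) (y : Fin N → β) => ψ (y l) - ∫ x, ψ x ∂p)
      (Measure.pi fun _ : Fin N => p) :=
    iIndepFun_pi (X := fun (_ : Fin N) y => ψ y - ∫ x, ψ x ∂p) fun _ => hmeas.aemeasurable
  have hs : ∀ l : Fin N, HasSubgaussianMGF (fun y : Fin N → β => ψ (y l) - ∫ x, ψ x ∂p)
      ((‖m - -m‖₊ / 2) ^ 2) (Measure.pi fun _ : Fin N => p) := fun l => by
    refine HasSubgaussianMGF.of_map (X := fun x => ψ x - ∫ x, ψ x ∂p)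
      (Y := fun y : Fin N → β => y l) (measurable_pi_apply l).aemeasurable ?_
    rw [(measurePreserving_eval (fun _ : Fin N => p) l).map_eq]
    exact hsub
  have := HasSubgaussianMGF.measure_sum_ge_le_of_iIndepFun hind (s := Finset.univ)
    (fun l _ => hs l) (ε := N * δ) (by positivity)
  convert this using 2
  · congr 1
    ext y
    simp only [Finset.sum_sub_distrib, Finset.sum_const, Finset.card_univ, Fintype.card_fin,
      nsmul_eq_mul]
    rw [← mul_le_mul_iff_right₀ hN, mul_sub, mul_inv_cancel_left₀ hN.ne']
  · simp only [Finset.sum_const, Finset.card_univ, Fintype.card_fin, nsmul_eq_mul]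
    push_cast
    have : ‖m - -m‖ = 2 * m := by rw [Real.norm_of_nonneg (by linarith)]; ring
    rw [this]
    field_simp

/-- **Hoeffding's inequality** for the sample mean of `N` independent draws from `p`. -/
theorem pi_abs_sampleMean_sub_ge_le (p : Measure β) [IsProbabilityMeasure p] (N : ℕ) [NeZero N]
    {ψ : β → ℝ} (hψ : Measurable ψ) {m : ℝ} (hm : 0 < m) (hb : ∀ᵐ y ∂p, |ψ y| ≤ m)
    {δ : ℝ} (hδ : 0 ≤ δ) :
    (Measure.pi fun _ : Fin N => p) {y | δ ≤ |(N : ℝ)⁻¹ * ∑ l, ψ (y l) - ∫ x, ψ x ∂p|}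
      ≤ ENNReal.ofReal (2 * Real.exp (-(N * δ ^ 2 / (2 * m ^ 2)))) := by
  have h1 := pi_sampleMean_sub_ge_le p N hψ hm hb hδ
  have h2 := pi_sampleMean_sub_ge_le p N hψ.neg hm (by simpa using hb) hδ
  rw [← ENNReal.ofReal_toReal (measure_ne_top _ _), ← measureReal_def]
  refine ENNReal.ofReal_le_ofReal (le_trans ?_ (le_trans (add_le_add h1 h2) (two_mul _).ge))
  refine le_trans (measureReal_mono ?_) (measureReal_union_le _ _)
  intro y hy
  simp only [Set.mem_ofPred_eq, le_abs] at hy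
  refine hy.imp id fun h => ?_
  simp only [Pi.neg_apply, Finset.sum_neg_distrib, integral_neg, Set.mem_ofPred_eq]
  linarith

/-- This is the conditioning step: a bad past costs at most its own probability, and a good past
leaves only the conditional probability. -/
theorem compProd_le_add (μ : Measure α) [IsProbabilityMeasure μ] (κ : Kernel α β)
    [IsMarkovKernel κ] {G : Set α} (hG : MeasurableSet G) {E : Set (α × β)}
    (hE : MeasurableSet E) {a b : ℝ≥0∞} (ha : μ Gᶜ ≤ a)
    (hb : ∀ x ∈ G, κ x {y | (x, y) ∈ E} ≤ b) : (μ ⊗ₘ κ) E ≤ a + b := by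
  rw [Measure.compProd_apply hE]
  calc ∫⁻ x, κ x (Prod.mk x ⁻¹' E) ∂μ ≤ ∫⁻ x, (Gᶜ.indicator 1 x + b) ∂μ := by
        refine lintegral_mono fun x => ?_
        by_cases hx : x ∈ G
        · exact le_trans (hb x hx) le_add_self
        · simp only [Set.indicator_of_mem (Set.mem_compl hx), Pi.one_apply]
          exact le_trans prob_le_one le_self_add
    _ = μ Gᶜ + b := by
        rw [lintegral_add_right _ measurable_const, lintegral_indicator_one hG.compl]
        simp
    _ ≤ a + b := by gcongr

theorem chainLaw_succ_le_add (μ : Measure S) [IsProbabilityMeasure μ] (κ : ℕ → Kernel S S)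
    [∀ t, IsMarkovKernel (κ t)] (t : ℕ) {G E : Set (ℕ → S)} (hG : MeasurableSet G)
    (hE : MeasurableSet E) {a b : ℝ≥0∞} (ha : chainLaw μ κ t Gᶜ ≤ a)
    (hb : ∀ x ∈ G, κ (t + 1) (x t) {y | Function.update x (t + 1) y ∈ E} ≤ b) :
    chainLaw μ κ (t + 1) E ≤ a + b := by
  rw [chainLaw, Measure.map_apply (measurable_extend t) hE]
  exact compProd_le_add _ _ hG (measurable_extend t hE) ha hb

theorem mixture_apply {ι : Type*} [Fintype ι] (w : α → ι → ℝ≥0)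
    (hw : ∀ i, Measurable fun a => w a i) (κ : ι → Kernel α β) (a : α) :
    mixture w hw κ a = ∑ i, (w a i : ℝ≥0∞) • κ i a := rfl

theorem integral_mixture {ι : Type*} [Fintype ι] (w : α → ι → ℝ≥0)
    (hw : ∀ i, Measurable fun a => w a i) (κ : ι → Kernel α β) (a : α) {f : β → ℝ}
    (hf : ∀ i, Integrable f (κ i a)) :
    ∫ y, f y ∂mixture w hw κ a = ∑ i, (w a i : ℝ) * ∫ y, f y ∂κ i a := by
  rw [mixture_apply, integral_finsetSum_measure fun i _ => (hf i).smul_measure ENNReal.coe_ne_top]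
  simp [NNReal.smul_def]

/-- Written without division, the identity survives when all weights vanish, so the uniform
convention never needs separate treatment below. -/
theorem sum_mul_normalize {N : ℕ} (w : Fin N → ℝ≥0) (i : Fin N) :
    (∑ l, w l) * normalize w i = w i := by
  unfold normalize
  split_ifs with h
  · rw [h, zero_mul, (Finset.sum_eq_zero_iff.1 h) i (Finset.mem_univ i)]
  · exact mul_div_cancel₀ _ h

theorem sum_coe_normalize {N : ℕ} [NeZero N] (w : Fin N → ℝ≥0) :
    ∑ i, (normalize w i : ℝ) = 1 := by
  exact_mod_cast sum_normalize w

/-- A weighted average of quantities bounded by `m` is bounded by `m`. -/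
theorem abs_sum_mul_le {ι : Type*} [Fintype ι] {w : ι → ℝ≥0} (hw : ∑ i, w i = 1) {v : ι → ℝ}
    {m : ℝ} (hv : ∀ i, |v i| ≤ m) : |∑ i, (w i : ℝ) * v i| ≤ m := by
  calc |∑ i, (w i : ℝ) * v i| ≤ ∑ i, (w i : ℝ) * m := by
        refine (Finset.abs_sum_le_sum_abs _ _).trans (Finset.sum_le_sum fun i _ => ?_)
        rw [abs_mul, abs_of_nonneg (NNReal.coe_nonneg (w i))]
        exact mul_le_mul_of_nonneg_left (hv i) (w i).2
    _ = m := by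
        rw [← Finset.sum_mul]
        have : ∑ i, (w i : ℝ) = 1 := by exact_mod_cast hw
        rw [this, one_mul]

theorem integrable_of_abs_le {μ : Measure α} [IsFiniteMeasure μ] {f : α → ℝ} (hf : Measurable f)
    {m : ℝ} (hm : ∀ x, |f x| ≤ m) : Integrable f μ :=
  Integrable.of_bound hf.aestronglyMeasurable m (.of_forall hm)

theorem integral_densityKernel (ν : Measure S) [SigmaFinite ν] {f : S → S → ℝ≥0}
    (hf : Measurable (Function.uncurry f)) (x : S) (v : S → ℝ) :
    ∫ y, v y ∂densityKernel ν f x = ∫ y, (f x y : ℝ) * v y ∂ν := by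
  have hm : Measurable (Function.uncurry fun x x' => (f x x' : ℝ≥0∞)) := hf.coe_nnreal_ennreal
  rw [densityKernel, Kernel.withDensity_apply _ hm, Kernel.const_apply,
    integral_withDensity_eq_integral_smul (hf.of_uncurry_left (x := x))]
  rfl

end Concentration

variable {X : Type*} [MeasurableSpace X]

/-! ### Integrating out the future and averaging over the past -/

namespace StateSpaceModel

variable (M : StateSpaceModel X)

/-- `E[g_{t+1}(X_{t+1}) f(X_{0:t+1}) | X_{0:t} = x_{0:t}]`. -/
def lookStep (t : ℕ) (f : (ℕ → X) → ℝ) (x : ℕ → X) : ℝ :=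
  ∫ y, (M.g (t + 1) y : ℝ) * f (Function.update x (t + 1) y) ∂M.Q (x t)

/-- `E[g_{t+1}(X_{t+1}) ⋯ g_{t+n}(X_{t+n}) f(X_{0:t+n}) | X_{0:t} = x_{0:t}]`. -/
def lookahead : ℕ → ℕ → ((ℕ → X) → ℝ) → (ℕ → X) → ℝ
  | _, 0, f => f
  | t, n + 1, f => M.lookStep t (lookahead (t + 1) n f)

/-- Average of `f` over the coordinates `< t` of the path, drawn by the backward Markov chain on the
clouds `c` started at time `t` from `x t`. -/
def retro {N : ℕ} (c : ℕ → Cloud N X) : ℕ → ((ℕ → X) → ℝ) → (ℕ → X) → ℝ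
  | 0, f, x => f x
  | t + 1, f, x => ∑ i, (normalize (fun l => (c t l).2 * M.q (c t l).1 (x (t + 1))) i : ℝ) *
      retro c t f (Function.update x t (c t i).1)

theorem measurable_update' {Y : Type*} [MeasurableSpace Y] {u : Y → ℕ → X} (hu : Measurable u)
    (t : ℕ) {v : Y → X} (hv : Measurable v) : Measurable fun y => Function.update (u y) t (v y) := by
  refine measurable_pi_lambda _ fun n => ?_
  by_cases h : n = t
  · subst h; simpa using hv
  · simpa [Function.update_of_ne h] using hu.eval

theorem measurable_lookStep (t : ℕ) {f : (ℕ → X) → ℝ} (hf : Measurable f) :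
    Measurable (M.lookStep t f) := by
  have h : Measurable fun z : (ℕ → X) × X =>
      (M.g (t + 1) z.2 : ℝ) * f (Function.update z.1 (t + 1) z.2) :=
    ((M.measurable_g _).comp measurable_snd).coe_nnreal_real.mul
      (hf.comp (measurable_update' measurable_fst _ measurable_snd))
  exact (h.stronglyMeasurable.integral_kernel_prod_right'
    (κ := M.Q.comap (fun x : ℕ → X => x t) (measurable_pi_apply t))).measurable

theorem abs_lookStep_le {t : ℕ} {b : ℝ≥0} (hb : ∀ x, M.g (t + 1) x ≤ b) {f : (ℕ → X) → ℝ} {m : ℝ}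
    (hf : ∀ x, |f x| ≤ m) (x : ℕ → X) : |M.lookStep t f x| ≤ b * m := by
  have := norm_integral_le_of_norm_le_const (μ := M.Q (x t)) (C := b * m)
    (f := fun y => (M.g (t + 1) y : ℝ) * f (Function.update x (t + 1) y)) (.of_forall fun y => by
      rw [norm_mul, Real.norm_of_nonneg (NNReal.coe_nonneg _)]
      exact mul_le_mul (by exact_mod_cast hb y) (hf _) (norm_nonneg _) b.2)
  simpa [lookStep] using this

theorem integrable_lookStep {t : ℕ} {b : ℝ≥0} (hb : ∀ x, M.g (t + 1) x ≤ b) {f : (ℕ → X) → ℝ}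
    (hfm : Measurable f) {m : ℝ} (hf : ∀ x, |f x| ≤ m) (x : ℕ → X) (z : X) :
    Integrable (fun y => (M.g (t + 1) y : ℝ) * f (Function.update x (t + 1) y)) (M.Q z) := by
  refine integrable_of_abs_le (m := b * m) ?_ fun y => ?_
  · exact (M.measurable_g _).coe_nnreal_real.mul
      (hfm.comp (measurable_update' measurable_const _ measurable_id))
  · rw [abs_mul, abs_of_nonneg (NNReal.coe_nonneg _)]
    exact mul_le_mul (by exact_mod_cast hb y) (hf _) (abs_nonneg _) b.2

theorem measurable_lookahead (n : ℕ) : ∀ (t : ℕ) {f : (ℕ → X) → ℝ}, Measurable f →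
    Measurable (M.lookahead t n f) := by
  induction n with
  | zero => exact fun _ _ hf => hf
  | succ n ih => exact fun t f hf => M.measurable_lookStep t (ih (t + 1) hf)

theorem abs_lookahead_le {T : ℕ} {b : ℝ≥0} (hb : ∀ t ≤ T, ∀ x, M.g t x ≤ b) {f : (ℕ → X) → ℝ}
    {m : ℝ} (hf : ∀ x, |f x| ≤ m) (n : ℕ) : ∀ t, t + n ≤ T → ∀ x,
    |M.lookahead t n f x| ≤ b ^ n * m := by
  induction n with
  | zero => intro t _ x; simpa [lookahead] using hf x
  | succ n ih =>
    intro t ht x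
    have := M.abs_lookStep_le (hb (t + 1) (by omega)) (ih (t + 1) (by omega)) x
    rw [lookahead, pow_succ']
    linarith

theorem lookahead_sub_const_mul {T : ℕ} {b : ℝ≥0} (hb : ∀ t ≤ T, ∀ x, M.g t x ≤ b)
    {f f' : (ℕ → X) → ℝ} (hfm : Measurable f) (hfm' : Measurable f') {m : ℝ} (hf : ∀ x, |f x| ≤ m)
    (hf' : ∀ x, |f' x| ≤ m) (r : ℝ) (n : ℕ) : ∀ t, t + n ≤ T →
    M.lookahead t n (fun x => f x - r * f' x) =
      fun x => M.lookahead t n f x - r * M.lookahead t n f' x := by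
  induction n with
  | zero => intro t _; rfl
  | succ n ih =>
    intro t ht
    funext x
    simp only [lookahead, ih (t + 1) (by omega), lookStep]
    have hg := hb (t + 1) (by omega)
    rw [← integral_const_mul, ← integral_sub
      (M.integrable_lookStep hg (M.measurable_lookahead n _ hfm)
        (M.abs_lookahead_le hb hf n _ (by omega)) _ _)
      ((M.integrable_lookStep hg (M.measurable_lookahead n _ hfm')
        (M.abs_lookahead_le hb hf' n _ (by omega)) _ _).const_mul r)]
    congr 1
    funext y
    ring

theorem dependsOn_lookahead {f : (ℕ → X) → ℝ} (n : ℕ) : ∀ t, DependsOn f (Set.Iic (t + n)) →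
    DependsOn (M.lookahead t n f) (Set.Iic t) := by
  induction n with
  | zero => exact fun t hf => hf
  | succ n ih =>
    intro t hf x y hxy
    have := ih (t + 1) (by rwa [add_right_comm])
    simp only [lookahead, lookStep, hxy t (Set.mem_Iic.2 le_rfl)]
    congr 1
    funext z
    congr 1
    refine this fun i hi => ?_
    rcases eq_or_ne i (t + 1) with rfl | h
    · simp
    · simpa [Function.update_of_ne h] using hxy i (by simp only [Set.mem_Iic] at hi ⊢; omega)

variable {N : ℕ}

theorem measurable_retro {Y : Type*} [MeasurableSpace Y] {f : (ℕ → X) → ℝ} (hf : Measurable f)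
    (t : ℕ) : ∀ {c : Y → ℕ → Cloud N X} {x : Y → ℕ → X}, Measurable c → Measurable x →
    Measurable fun y => M.retro (c y) t f (x y) := by
  induction t with
  | zero => exact fun _ hx => hf.comp hx
  | succ t ih =>
    intro c x hc hx
    have h : ∀ l, Measurable fun y => c y t l := fun l => hc.eval.eval
    refine Finset.measurable_sum _ fun i _ => ?_
    refine (measurable_normalize (fun l => ?_) i).coe_nnreal_real.mul
      (ih hc (measurable_update' hx _ (h i).fst))
    exact (h l).snd.mul (M.measurable_q.comp ((h l).fst.prodMk hx.eval))

theorem abs_retro_le [NeZero N] (c : ℕ → Cloud N X) {f : (ℕ → X) → ℝ} {m : ℝ}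
    (hf : ∀ x, |f x| ≤ m) (t : ℕ) : ∀ x, |M.retro c t f x| ≤ m := by
  induction t with
  | zero => exact hf
  | succ t ih => exact fun x => abs_sum_mul_le (sum_normalize _) fun i => ih _

theorem retro_sub_const_mul (c : ℕ → Cloud N X) (f f' : (ℕ → X) → ℝ) (r : ℝ) (t : ℕ) : ∀ x,
    M.retro c t (fun x => f x - r * f' x) x = M.retro c t f x - r * M.retro c t f' x := by
  induction t with
  | zero => exact fun _ => rfl
  | succ t ih =>
    intro x
    simp only [retro, ih, Finset.mul_sum, ← Finset.sum_sub_distrib]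
    exact Finset.sum_congr rfl fun i _ => by ring

theorem retro_one [NeZero N] (c : ℕ → Cloud N X) (t : ℕ) :
    ∀ x, M.retro c t (fun _ => 1) x = 1 := by
  induction t with
  | zero => exact fun _ => rfl
  | succ t ih => intro x; simp only [retro, ih, mul_one]; exact sum_coe_normalize _

theorem retro_congr_cloud (f : (ℕ → X) → ℝ) (t : ℕ) {c c' : ℕ → Cloud N X}
    (h : ∀ u < t, c u = c' u) : ∀ x, M.retro c t f x = M.retro c' t f x := by
  induction t with
  | zero => exact fun _ => rfl
  | succ t ih =>
    intro x
    simp only [retro, h t (Nat.lt_succ_self t), ih fun u hu => h u (hu.trans (Nat.lt_succ_self t))]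

/-- The backward chain overwrites every coordinate below t, so the values that the starting path has
there are placeholders. -/
theorem retro_congr_path (c : ℕ → Cloud N X) {f : (ℕ → X) → ℝ} {m : ℕ}
    (hf : DependsOn f (Set.Iic m)) (t : ℕ) (ht : t ≤ m) : ∀ x y : ℕ → X,
    (∀ i, t ≤ i → i ≤ m → x i = y i) → M.retro c t f x = M.retro c t f y := by
  induction t with
  | zero => exact fun x y h => hf fun i hi => h i (Nat.zero_le i) hi
  | succ t ih =>
    intro x y h
    simp only [retro, h (t + 1) le_rfl ht]
    refine Finset.sum_congr rfl fun i _ => ?_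
    rw [ih (by omega) _ _ fun j hj hjm => ?_]
    rcases eq_or_ne j t with rfl | hne
    · simp
    · simpa [Function.update_of_ne hne] using h j (by omega) hjm

/-- The backward weights used below u ≤ t never read the coordinate t + 1, so the finite backward
average commutes with the integral over the next state. -/
theorem retro_lookStep [NeZero N] (c : ℕ → Cloud N X) {t : ℕ} {b : ℝ≥0}
    (hb : ∀ x, M.g (t + 1) x ≤ b) {f : (ℕ → X) → ℝ} (hfm : Measurable f) {m : ℝ}
    (hf : ∀ x, |f x| ≤ m) (u : ℕ) (hu : u ≤ t) : ∀ x, M.retro c u (M.lookStep t f) x =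
    ∫ y, (M.g (t + 1) y : ℝ) * M.retro c u f (Function.update x (t + 1) y) ∂M.Q (x t) := by
  induction u with
  | zero => exact fun _ => rfl
  | succ u ih =>
    intro x
    have hne : u + 1 ≠ t + 1 := by omega
    have hne' : t ≠ u := by omega
    simp only [retro, ih (by omega), Function.update_of_ne hne, Function.update_of_ne hne',
      Finset.mul_sum, ← integral_const_mul]
    rw [integral_finsetSum]
    · refine Finset.sum_congr rfl fun i _ => integral_congr_ae (.of_forall fun y => ?_)
      dsimp only
      rw [Function.update_comm (by omega : u ≠ t + 1)]
      ring
    · intro i _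
      refine integrable_of_abs_le (m := b * m) ?_ fun y => ?_
      · refine (M.measurable_g _).coe_nnreal_real.mul (measurable_const.mul ?_)
        exact M.measurable_retro hfm u measurable_const (measurable_update'
          (measurable_update' measurable_const _ measurable_id) _ measurable_const)
      · rw [abs_mul, abs_of_nonneg (NNReal.coe_nonneg _)]
        refine mul_le_mul (by exact_mod_cast hb y) ?_ (abs_nonneg _) b.2
        rw [abs_mul, abs_of_nonneg (NNReal.coe_nonneg _)]
        refine (mul_le_of_le_one_left (abs_nonneg _) ?_).trans (M.abs_retro_le c hf u _)
        rw [NNReal.coe_le_one, ← sum_normalize fun l => (c u l).2 * M.q (c u l).1 (x (u + 1))]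
        exact Finset.single_le_sum (f := normalize _) (fun j _ => zero_le)
          (Finset.mem_univ i)

end StateSpaceModel

/-! ### The unnormalised estimators -/

namespace StateSpaceModel

variable (M : StateSpaceModel X) {N : ℕ}

/-- The contribution of a weighted particle `y` at time `t` to the unnormalised estimator of
`f(X_{0:T})`: the past is drawn backward from the clouds `c`, the future is integrated out. -/
def score (T t : ℕ) (f : (ℕ → X) → ℝ) (c : ℕ → Cloud N X) (y : X × ℝ≥0) : ℝ :=
  y.2 * M.retro c t (M.lookahead t (T - t) f) fun _ => y.1

/-- The unnormalised estimator of `f(X_{0:T})` at time `t`. -/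
def average (T t : ℕ) (f : (ℕ → X) → ℝ) (c : ℕ → Cloud N X) : ℝ :=
  (N : ℝ)⁻¹ * ∑ l, M.score T t f c (c t l)

theorem lookahead_eq_lookStep {T t : ℕ} (ht : t < T) (f : (ℕ → X) → ℝ) :
    M.lookahead t (T - t) f = M.lookStep t (M.lookahead (t + 1) (T - (t + 1)) f) := by
  rw [show T - t = (T - (t + 1)) + 1 by omega, lookahead]

theorem measurable_score {Y : Type*} [MeasurableSpace Y] {f : (ℕ → X) → ℝ} (hf : Measurable f)
    (T t : ℕ) {c : Y → ℕ → Cloud N X} (hc : Measurable c) {y : Y → X × ℝ≥0} (hy : Measurable y) :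
    Measurable fun z => M.score T t f (c z) (y z) :=
  hy.snd.coe_nnreal_real.mul (M.measurable_retro (M.measurable_lookahead _ _ hf) t hc
    (measurable_pi_lambda _ fun _ => hy.fst))

theorem measurable_average {f : (ℕ → X) → ℝ} (hf : Measurable f) (T t : ℕ) :
    Measurable fun c : ℕ → Cloud N X => M.average T t f c :=
  measurable_const.mul (Finset.measurable_sum _ fun l _ => M.measurable_score hf T t measurable_id
    ((measurable_pi_apply l).comp (measurable_pi_apply t)))

theorem score_congr (T t : ℕ) (f : (ℕ → X) → ℝ) {c c' : ℕ → Cloud N X} (h : ∀ u < t, c u = c' u)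
    (y : X × ℝ≥0) : M.score T t f c y = M.score T t f c' y := by
  rw [score, score, M.retro_congr_cloud _ t h]

variable {T : ℕ} {b : ℝ≥0}

theorem abs_score_le [NeZero N] (hb : ∀ t ≤ T, ∀ x, M.g t x ≤ b) {t : ℕ} (ht : t ≤ T) (hb1 : 1 ≤ b) {f : (ℕ → X) → ℝ} {m : ℝ}
    (hm : 0 ≤ m) (hf : ∀ x, |f x| ≤ m) (c : ℕ → Cloud N X) {y : X × ℝ≥0} (hy : y.2 ≤ b) :
    |M.score T t f c y| ≤ b ^ (T + 1) * m := by
  have h1 := M.abs_retro_le c (M.abs_lookahead_le hb hf (T - t) t (by omega)) t fun _ => y.1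
  have h2 : (b : ℝ) ^ (T - t) ≤ (b : ℝ) ^ T := pow_le_pow_right₀ (by exact_mod_cast hb1) (by omega)
  rw [score, abs_mul, abs_of_nonneg (NNReal.coe_nonneg _), pow_succ', mul_assoc]
  exact mul_le_mul (by exact_mod_cast hy) (h1.trans (by gcongr)) (abs_nonneg _) b.2

theorem score_sub_const_mul (hb : ∀ t ≤ T, ∀ x, M.g t x ≤ b) {t : ℕ} (ht : t ≤ T) {f f' : (ℕ → X) → ℝ} (hfm : Measurable f)
    (hfm' : Measurable f') {m : ℝ} (hf : ∀ x, |f x| ≤ m) (hf' : ∀ x, |f' x| ≤ m) (r : ℝ)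
    (c : ℕ → Cloud N X) (y : X × ℝ≥0) :
    M.score T t (fun x => f x - r * f' x) c y = M.score T t f c y - r * M.score T t f' c y := by
  rw [score, M.lookahead_sub_const_mul hb hfm hfm' hf hf' r _ _ (by omega), retro_sub_const_mul,
    score, score]
  ring

theorem average_sub_const_mul (hb : ∀ t ≤ T, ∀ x, M.g t x ≤ b) {t : ℕ} (ht : t ≤ T) {f f' : (ℕ → X) → ℝ} (hfm : Measurable f)
    (hfm' : Measurable f') {m : ℝ} (hf : ∀ x, |f x| ≤ m) (hf' : ∀ x, |f' x| ≤ m) (r : ℝ)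
    (c : ℕ → Cloud N X) :
    M.average T t (fun x => f x - r * f' x) c = M.average T t f c - r * M.average T t f' c := by
  simp only [average, M.score_sub_const_mul hb ht hfm hfm' hf hf', Finset.sum_sub_distrib,
    ← Finset.mul_sum]
  ring

end StateSpaceModel

theorem integrable_density_mul {S : Type*} [MeasurableSpace S] (ν : Measure S) [SigmaFinite ν]
    {f : S → S → ℝ≥0} (hf : Measurable (Function.uncurry f))
    (h1 : ∀ x, ∫⁻ x', (f x x' : ℝ≥0∞) ∂ν = 1) (x : S) {v : S → ℝ}
    (hv : Measurable v) {m : ℝ} (hm : ∀ y, |v y| ≤ m) :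
    Integrable (fun y => (f x y : ℝ) * v y) ν := by
  have := isMarkovKernel_densityKernel ν hf h1
  have hi : Integrable v (densityKernel ν f x) := integrable_of_abs_le hv hm
  have hm : Measurable (Function.uncurry fun x x' => (f x x' : ℝ≥0∞)) := hf.coe_nnreal_ennreal
  rw [densityKernel, Kernel.withDensity_apply _ hm, Kernel.const_apply,
    integrable_withDensity_iff_integrable_smul (hf.of_uncurry_left (x := x))] at hi
  exact hi

/-! ### One-step conditional means of the scores -/

namespace Proposal

variable {M : StateSpaceModel X} (A : Proposal M) {N : ℕ}

/-- A finite weight forces the numerator to vanish wherever the denominator does, so clearing the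
denominator is legitimate everywhere. -/
theorem weight_mul {t : ℕ} {x x' : X} (h : A.weight t x x' ≠ ∞) :
    (A.ϑ t x : ℝ) * (A.p t x x' * (A.weight t x x').toNNReal) = M.q x x' * M.g t x' := by
  rw [← mul_assoc]
  norm_cast
  rw [← ENNReal.coe_inj]
  push_cast
  rw [ENNReal.coe_toNNReal h]
  unfold weight at h ⊢
  rcases eq_or_ne ((A.ϑ t x : ℝ≥0∞) * A.p t x x') 0 with h0 | h0
  · have : (M.q x x' : ℝ≥0∞) * M.g t x' = 0 := by
      by_contra hne
      exact h (by rw [h0, ENNReal.div_zero hne])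
    rw [h0, this]; simp
  · exact ENNReal.mul_div_cancel h0 (by finiteness)

theorem move_apply (t : ℕ) (x : X) :
    A.move t x = (A.P t x).map fun y => (y, (A.weight t x y).toNNReal) := by
  rw [move, Kernel.map_apply _ (A.measurable_move t), Kernel.prod_apply, Kernel.id_apply,
    Measure.dirac_prod, Measure.map_map (A.measurable_move t) measurable_prodMk_left]
  rfl

theorem measurable_weighted (t : ℕ) (x : X) :
    Measurable fun y => (y, (A.weight t x y).toNNReal) :=
  (A.measurable_move t).comp measurable_prodMk_left

variable {T : ℕ} {b : ℝ≥0}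

theorem move_le (t : ℕ) (hw : ∀ x x', A.weight t x x' ≤ b) (x : X) :
    ∀ᵐ y ∂A.move t x, y.2 ≤ b := by
  rw [move_apply, ae_map_iff (A.measurable_weighted t x).aemeasurable
    (measurableSet_le measurable_snd measurable_const)]
  exact .of_forall fun y =>
    (ENNReal.toNNReal_mono ENNReal.coe_ne_top (hw x y)).trans_eq (ENNReal.toNNReal_coe b)

theorem newParticle_le [NeZero N] (t : ℕ) (hw : ∀ x x', A.weight t x x' ≤ b) (c : Cloud N X) :
    ∀ᵐ y ∂A.newParticle N t c, y.2 ≤ b := by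
  rw [newParticle, mixture_apply]
  simp only [Kernel.comap_apply]
  rw [ae_iff]
  simp only [Measure.coe_finsetSum, Finset.sum_apply, Measure.smul_apply, smul_eq_mul]
  exact Finset.sum_eq_zero fun i _ => by rw [ae_iff.1 (A.move_le t hw _), mul_zero]

theorem initParticle_le (hw : ∀ᵐ x ∂A.ρ₀, A.weight₀ x ≤ b) :
    ∀ᵐ y ∂A.initParticle, y.2 ≤ b := by
  rw [initParticle, ae_map_iff A.measurable_initParticle.aemeasurable
    (measurableSet_le measurable_snd measurable_const)]
  exact hw.mono fun y hy =>
    (ENNReal.toNNReal_mono ENNReal.coe_ne_top hy).trans_eq (ENNReal.toNNReal_coe b)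

/-- Importance sampling: the adjustment multiplier, the proposal density and the weight recombine
into the true dynamics q times the likelihood. -/
theorem adjust_mul_integral_move {t : ℕ} (hw : ∀ x x', A.weight t x x' ≤ b) (x : X) {v : X → ℝ}
    (hv : Measurable v) : (A.ϑ t x : ℝ) * ∫ y, (y.2 : ℝ) * v y.1 ∂A.move t x =
      ∫ y, (M.q x y : ℝ) * (M.g t y * v y) ∂M.ν := by
  have hm : Measurable fun y : X × ℝ≥0 => (y.2 : ℝ) * v y.1 :=
    measurable_snd.coe_nnreal_real.mul (hv.comp measurable_fst)
  rw [move_apply, integral_map (A.measurable_weighted t x).aemeasurable hm.aestronglyMeasurable, P,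
    integral_densityKernel _ (A.measurable_p t), ← integral_const_mul]
  congr 1
  funext y
  have := A.weight_mul (ne_top_of_le_ne_top ENNReal.coe_ne_top (hw x y))
  dsimp only
  linear_combination v y * this

/-- Conditionally on the clouds up to time `t`, the new particles estimate the same quantity as the
old ones, up to the normalising factor of the ancestor probabilities. -/
theorem adjust_mul_integral_score [NeZero N] {t : ℕ} (ht : t < T)
    (hb : ∀ t ≤ T, ∀ x, M.g t x ≤ b) (hb1 : 1 ≤ b) (hw : ∀ x x', A.weight (t + 1) x x' ≤ b)
    {f : (ℕ → X) → ℝ} (hfm : Measurable f) {m : ℝ} (hf : ∀ x, |f x| ≤ m)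
    (hdep : DependsOn f (Set.Iic T)) (c : ℕ → Cloud N X) :
    ((N : ℝ)⁻¹ * ∑ l, ((c t l).2 : ℝ) * A.ϑ (t + 1) (c t l).1) *
      ∫ y, M.score T (t + 1) f c y ∂A.newParticle N (t + 1) (c t) = M.average T t f c := by
  have hm : 0 ≤ m := (abs_nonneg _).trans (hf fun _ => (c t 0).1)
  set F := M.lookahead (t + 1) (T - (t + 1)) f with hF
  have hFm : Measurable F := M.measurable_lookahead _ _ hfm
  have hFb := M.abs_lookahead_le hb hf (T - (t + 1)) (t + 1) (by omega)
  have hFd : DependsOn F (Set.Iic (t + 1)) :=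
    M.dependsOn_lookahead _ _ (by rwa [show t + 1 + (T - (t + 1)) = T by omega])
  set Φ : X → ℝ := fun y => M.retro c (t + 1) F fun _ => y with hΦ
  have hcm : Measurable fun _ : X => c := measurable_const
  have hΦm : Measurable Φ := M.measurable_retro hFm (t + 1) hcm
    (measurable_pi_lambda _ fun _ => measurable_id)
  let H : Fin N → X → ℝ := fun k y =>
    M.retro c t F (Function.update (fun _ => (c t k).1) (t + 1) y)
  have hHm : ∀ k, Measurable (H k) := fun k => M.measurable_retro hFm t hcm
    (StateSpaceModel.measurable_update' measurable_const _ measurable_id)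
  -- One backward step is unrolled. The two starting paths agree at t and t + 1, the only
  -- coordinates that matter, and the form `H k` is the one that `retro_lookStep` produces.
  have hΦH : ∀ y, Φ y =
      ∑ k, (normalize (fun l => (c t l).2 * M.q (c t l).1 y) k : ℝ) * H k y := fun y => by
    refine Finset.sum_congr rfl fun k _ => ?_
    congr 1
    refine M.retro_congr_path c hFd t (by omega) _ _ fun i hi hi' => ?_
    rcases (show i = t ∨ i = t + 1 by omega) with rfl | rfl <;> simp
  have hint : ∀ i, ∀ {v : X → ℝ}, Measurable v → (∀ y, |v y| ≤ b ^ (T - (t + 1)) * m) →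
      Integrable (fun y => ((c t i).2 : ℝ) * ((M.q (c t i).1 y : ℝ) * (M.g (t + 1) y * v y)))
        M.ν := by
    intro i v hv hvb
    refine Integrable.const_mul (integrable_density_mul M.ν M.measurable_q M.lintegral_q _
      ((M.measurable_g _).coe_nnreal_real.mul hv) (m := b * (b ^ (T - (t + 1)) * m))
      fun y => ?_) _
    rw [Pi.mul_apply, abs_mul, abs_of_nonneg (NNReal.coe_nonneg _)]
    exact mul_le_mul (by exact_mod_cast hb (t + 1) ht y) (hvb y) (abs_nonneg _) b.2
  have hscore : ∀ y, M.score T (t + 1) f c y = (y.2 : ℝ) * Φ y.1 := fun _ => rfl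
  have hsi : ∀ i, Integrable (M.score T (t + 1) f c) (A.move (t + 1) (c t i).1) := fun i =>
    Integrable.of_bound (M.measurable_score hfm T (t + 1) measurable_const
      measurable_id).aestronglyMeasurable (b ^ (T + 1) * m)
      ((A.move_le (t + 1) hw _).mono fun y hy => M.abs_score_le hb ht hb1 hm hf c hy)
  -- The factor in front undoes the normalisation of the ancestor probabilities.
  have hnorm : ∀ i, (∑ l, ((c t l).2 : ℝ) * A.ϑ (t + 1) (c t l).1) *
      (A.ancestorProb (t + 1) (c t) i : ℝ) = (c t i).2 * A.ϑ (t + 1) (c t i).1 := fun i => by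
    exact_mod_cast sum_mul_normalize (fun l => (c t l).2 * A.ϑ (t + 1) (c t l).1) i
  rw [newParticle, integral_mixture _ _ _ _ hsi, mul_assoc, StateSpaceModel.average]
  congr 1
  calc (∑ l, ((c t l).2 : ℝ) * A.ϑ (t + 1) (c t l).1) * ∑ i, (A.ancestorProb (t + 1) (c t) i : ℝ) *
        ∫ y, M.score T (t + 1) f c y ∂A.move (t + 1) (c t i).1
      = ∑ i, ((c t i).2 : ℝ) * ∫ y, (M.q (c t i).1 y : ℝ) * (M.g (t + 1) y * Φ y) ∂M.ν := by
        rw [Finset.mul_sum]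
        refine Finset.sum_congr rfl fun i _ => ?_
        rw [← mul_assoc, hnorm, mul_assoc]
        simp only [hscore]
        rw [A.adjust_mul_integral_move hw _ hΦm]
    _ = ∫ y, ∑ i, ((c t i).2 : ℝ) * ((M.q (c t i).1 y : ℝ) * (M.g (t + 1) y * Φ y)) ∂M.ν := by
        rw [integral_finsetSum _ fun i _ => hint i hΦm fun y => M.abs_retro_le c hFb _ _]
        simp only [integral_const_mul]
    _ = ∫ y, ∑ i, ((c t i).2 : ℝ) * ((M.q (c t i).1 y : ℝ) * (M.g (t + 1) y * H i y)) ∂M.ν := by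
        congr 1
        funext y
        -- The mixture over ancestors supplies the denominator of the backward weights, at each
        -- fixed y; this cancellation replaces the actual ancestor by a backward draw.
        have hn : ∀ k, (∑ l, ((c t l).2 : ℝ) * M.q (c t l).1 y) *
            (normalize (fun l => (c t l).2 * M.q (c t l).1 y) k : ℝ) =
            (c t k).2 * M.q (c t k).1 y := fun k => by
          exact_mod_cast sum_mul_normalize (fun l => (c t l).2 * M.q (c t l).1 y) k
        calc _ = M.g (t + 1) y * ((∑ l, ((c t l).2 : ℝ) * M.q (c t l).1 y) * Φ y) := by
              rw [Finset.sum_mul, Finset.mul_sum]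
              exact Finset.sum_congr rfl fun i _ => by ring
          _ = M.g (t + 1) y * ∑ k, (c t k).2 * M.q (c t k).1 y * H k y := by
              rw [hΦH, Finset.mul_sum]
              simp only [← mul_assoc, hn]
          _ = _ := by
              rw [Finset.mul_sum]
              exact Finset.sum_congr rfl fun i _ => by ring
    _ = ∑ i, M.score T t f c (c t i) := by
        rw [integral_finsetSum _ fun i _ => hint i (hHm i) fun y => M.abs_retro_le c hFb _ _]
        refine Finset.sum_congr rfl fun i _ => ?_
        rw [integral_const_mul, StateSpaceModel.score, M.lookahead_eq_lookStep ht,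
          M.retro_lookStep c (hb (t + 1) ht) hFm hFb t le_rfl, StateSpaceModel.Q,
          integral_densityKernel _ M.measurable_q]

/-- There is no past to average at time 0, and the density of χ with respect to ρ₀ in the weight
changes the integral to one under χ. -/
theorem integral_score_zero {f : (ℕ → X) → ℝ} (hfm : Measurable f) (c : ℕ → Cloud N X) :
    ∫ y, M.score T 0 f c y ∂A.initParticle =
      ∫ x, (M.g 0 x : ℝ) * M.lookahead 0 T f (fun _ => x) ∂M.χ := by
  have hm : Measurable fun y => M.score T 0 f c y :=
    M.measurable_score hfm T 0 measurable_const measurable_id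
  rw [initParticle, integral_map A.measurable_initParticle.aemeasurable hm.aestronglyMeasurable,
    ← integral_rnDeriv_smul A.absolutelyContinuous]
  congr 1
  funext x
  simp only [StateSpaceModel.score, weight₀, StateSpaceModel.retro, smul_eq_mul, Nat.sub_zero,
    ENNReal.toNNReal_mul, ENNReal.toNNReal_coe, NNReal.coe_mul, mul_assoc]
  rfl

end Proposal

/-! ### The smoothing distribution in terms of the lookahead functions -/

theorem measurable_segment (s T : ℕ) : Measurable (segment s T : (ℕ → X) → _) :=
  measurable_pi_lambda _ fun _ => measurable_pi_apply _

namespace StateSpaceModel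

variable (M : StateSpaceModel X)

theorem measurable_likelihood (t : ℕ) : Measurable (M.likelihood t) :=
  Finset.measurable_prod _ fun u _ =>
    ((M.measurable_g u).comp (measurable_pi_apply u)).coe_nnreal_ennreal

theorem likelihood_ne_top (t : ℕ) (x : ℕ → X) : M.likelihood t x ≠ ∞ :=
  ENNReal.prod_ne_top fun _ _ => ENNReal.coe_ne_top

theorem likelihood_succ_update (t : ℕ) (x : ℕ → X) (y : X) :
    M.likelihood (t + 1) (Function.update x (t + 1) y) = M.likelihood t x * M.g (t + 1) y := by
  rw [likelihood, Finset.prod_range_succ, Function.update_self, likelihood]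
  congr 1
  refine Finset.prod_congr rfl fun u hu => ?_
  rw [Function.update_of_ne (by have := Finset.mem_range.1 hu; omega)]

instance (t : ℕ) : IsProbabilityMeasure (M.priorLaw t) := by
  unfold priorLaw; infer_instance

variable {T : ℕ} {b : ℝ≥0}

theorem toReal_likelihood_le (hb : ∀ t ≤ T, ∀ x, M.g t x ≤ b) {t : ℕ} (ht : t ≤ T) (x : ℕ → X) :
    (M.likelihood t x).toReal ≤ b ^ (t + 1) := by
  rw [likelihood, ENNReal.toReal_prod]
  refine (Finset.prod_le_prod (fun _ _ => ENNReal.toReal_nonneg) (g := fun _ => (b : ℝ))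
    fun u hu => ?_).trans (by simp)
  exact_mod_cast hb u (by have := Finset.mem_range.1 hu; omega) _

/-- Tower property: integrating out the last state of the prior chain turns the lookahead at t + 1
into the one at t, so the value is the same for all t. -/
theorem integral_likelihood_lookahead (hb : ∀ t ≤ T, ∀ x, M.g t x ≤ b) {f : (ℕ → X) → ℝ}
    (hfm : Measurable f) {m : ℝ} (hf : ∀ x, |f x| ≤ m) (t : ℕ) (ht : t ≤ T) :
    ∫ x, (M.likelihood t x).toReal * M.lookahead t (T - t) f x ∂M.priorLaw t =
      ∫ x, (M.g 0 x : ℝ) * M.lookahead 0 T f (fun _ => x) ∂M.χ := by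
  have hmeas : ∀ t, Measurable fun x : ℕ → X =>
      (M.likelihood t x).toReal * M.lookahead t (T - t) f x := fun t =>
    (M.measurable_likelihood t).ennreal_toReal.mul (M.measurable_lookahead _ _ hfm)
  induction t with
  | zero =>
    have hc : Measurable fun (x : X) (_ : ℕ) => x := measurable_pi_lambda _ fun _ => measurable_id
    rw [priorLaw, chainLaw, integral_map hc.aemeasurable (hmeas 0).aestronglyMeasurable]
    simp [likelihood]
  | succ t ih =>
    rw [← ih (by omega), priorLaw, chainLaw, integral_map (measurable_extend t).aemeasurable
      (hmeas (t + 1)).aestronglyMeasurable, Measure.integral_compProd]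
    · refine integral_congr_ae (.of_forall fun x => ?_)
      dsimp only
      rw [M.lookahead_eq_lookStep ht, lookStep, ← integral_const_mul]
      refine integral_congr_ae (.of_forall fun y => ?_)
      dsimp only
      rw [M.likelihood_succ_update, ENNReal.toReal_mul, mul_assoc]
      rfl
    · refine integrable_of_abs_le (m := b ^ (t + 1 + 1) * (b ^ (T - (t + 1)) * m))
        ((hmeas (t + 1)).comp (measurable_extend t)) fun z => ?_
      rw [abs_mul, abs_of_nonneg ENNReal.toReal_nonneg]
      exact mul_le_mul (M.toReal_likelihood_le hb ht _)
        (M.abs_lookahead_le hb hf _ _ (by omega) _) (abs_nonneg _) (by positivity)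

theorem toReal_evidence (hb : ∀ t ≤ T, ∀ x, M.g t x ≤ b) : (M.evidence T).toReal =
    ∫ x, (M.g 0 x : ℝ) * M.lookahead 0 T (fun _ => 1) (fun _ => x) ∂M.χ := by
  rw [← M.integral_likelihood_lookahead hb measurable_const (m := 1) (by simp) T le_rfl,
    evidence, ← integral_toReal (M.measurable_likelihood T).aemeasurable
      (.of_forall fun x => (M.likelihood_ne_top T x).lt_top)]
  simp [lookahead]

theorem evidence_ne_top (hb : ∀ t ≤ T, ∀ x, M.g t x ≤ b) : M.evidence T ≠ ∞ := by
  refine ne_top_of_le_ne_top (b := ((b ^ (T + 1) : ℝ≥0) : ℝ≥0∞)) ENNReal.coe_ne_top ?_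
  refine (lintegral_mono (g := fun _ => ((b ^ (T + 1) : ℝ≥0) : ℝ≥0∞)) fun x => ?_).trans (by simp)
  rw [← ENNReal.ofReal_toReal (M.likelihood_ne_top T x), ENNReal.ofReal_le_iff_le_toReal
    ENNReal.coe_ne_top]
  simpa using M.toReal_likelihood_le hb le_rfl x

/-- Links the target of the theorem to the mean score at time 0; centring h at its smoothing mean
makes that mean zero. -/
theorem evidence_mul_integral_smoothing (hb : ∀ t ≤ T, ∀ x, M.g t x ≤ b) (hpos : 0 < M.evidence T)
    (s : ℕ) {h : (Fin (T - s + 1) → X) → ℝ} (hm : Measurable h) {m : ℝ} (hh : ∀ x, |h x| ≤ m) :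
    (M.evidence T).toReal * ∫ x, h x ∂M.smoothing s T =
      ∫ x, (M.g 0 x : ℝ) * M.lookahead 0 T (fun x => h (segment s T x)) (fun _ => x) ∂M.χ := by
  have hfm : Measurable fun x : ℕ → X => h (segment s T x) := hm.comp (measurable_segment s T)
  rw [← M.integral_likelihood_lookahead hb hfm (fun x => hh _) T
    le_rfl, smoothing, integral_map (measurable_segment s T).aemeasurable hm.aestronglyMeasurable,
    integral_smul_measure, integral_withDensity_eq_integral_toReal_smul
      (M.measurable_likelihood T) (.of_forall fun x => (M.likelihood_ne_top T x).lt_top),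
    ENNReal.toReal_inv, smul_eq_mul, mul_inv_cancel_left₀
      (ENNReal.toReal_pos hpos.ne' (M.evidence_ne_top hb)).ne']
  simp [lookahead]

theorem isProbabilityMeasure_smoothing (hb : ∀ t ≤ T, ∀ x, M.g t x ≤ b) (hpos : 0 < M.evidence T)
    (s : ℕ) : IsProbabilityMeasure (M.smoothing s T) := by
  have : IsProbabilityMeasure
      ((M.evidence T)⁻¹ • (M.priorLaw T).withDensity (M.likelihood T)) := ⟨by
    rw [Measure.smul_apply, withDensity_apply _ MeasurableSet.univ, Measure.restrict_univ,
      smul_eq_mul]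
    exact ENNReal.inv_mul_cancel hpos.ne' (M.evidence_ne_top hb)⟩
  exact Measure.isProbabilityMeasure_map (measurable_segment s T).aemeasurable

end StateSpaceModel

/-! ### Good events and their propagation in time -/

theorem dependsOn_segment {X : Type*} {s T : ℕ} (hsT : s ≤ T) (h : (Fin (T - s + 1) → X) → ℝ) :
    DependsOn (fun x => h (segment s T x)) (Set.Iic T) := fun x y hxy => by
  dsimp only
  congr 1
  funext k
  exact hxy _ (by simp only [Set.mem_Iic]; omega)

namespace StateSpaceModel

variable (M : StateSpaceModel X) {N : ℕ}

/-- The event that, at time `t`, the weights are bounded by `b`, the normalising constant is at least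
`d`, and the normalised estimator of `f` is smaller than `r`. -/
def goodEvent (N T t : ℕ) (b : ℝ≥0) (d r : ℝ) (f : (ℕ → X) → ℝ) : Set (ℕ → Cloud N X) :=
  {c | (∀ l, (c t l).2 ≤ b) ∧ d ≤ M.average T t (fun _ => 1) c ∧
    |M.average T t f c| < r * M.average T t (fun _ => 1) c}

theorem measurableSet_goodEvent (T t : ℕ) (b : ℝ≥0) (d r : ℝ) {f : (ℕ → X) → ℝ}
    (hf : Measurable f) : MeasurableSet (M.goodEvent N T t b d r f) := by
  have h1 : Measurable fun c : ℕ → Cloud N X => M.average T t (fun _ => 1) c :=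
    M.measurable_average measurable_const T t
  have h2 : Measurable fun c : ℕ → Cloud N X => M.average T t f c := M.measurable_average hf T t
  have h3 : ∀ l : Fin N, Measurable fun c : ℕ → Cloud N X => (c t l).2 := fun l =>
    ((measurable_pi_apply l).comp (measurable_pi_apply t)).snd
  have h4 : MeasurableSet {c : ℕ → Cloud N X | ∀ l, (c t l).2 ≤ b} := by
    simp only [Set.ofPred_forall]
    exact .iInter fun l => measurableSet_le (h3 l) measurable_const
  exact h4.inter (.inter (measurableSet_le measurable_const h1)
    (measurableSet_lt (continuous_abs.measurable.comp h2) (measurable_const.mul h1)))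

theorem average_of_eq {T t : ℕ} {f : (ℕ → X) → ℝ} {c c' : ℕ → Cloud N X}
    (h : ∀ u < t, c' u = c u) :
    M.average T t f c' = (N : ℝ)⁻¹ * ∑ l, M.score T t f c (c' t l) := by
  simp only [average, M.score_congr T t f h]

/-- Hoeffding is applied to the scores of 1 and of f - r, where r is the quotient inherited from the
previous step. The insertion `U` covers both the initial cloud and a cloud appended to a given past.
-/
theorem pi_goodEvent_compl_le [NeZero N] {T t : ℕ} (ht : t ≤ T) {b : ℝ≥0} (hb1 : 1 ≤ b)
    (hb : ∀ t ≤ T, ∀ x, M.g t x ≤ b) (p : Measure (X × ℝ≥0)) [IsProbabilityMeasure p]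
    (hp : ∀ᵐ y ∂p, y.2 ≤ b) {f : (ℕ → X) → ℝ} (hfm : Measurable f) {o : ℝ} (ho : 0 < o)
    (hf : ∀ x, |f x| ≤ o) (c : ℕ → Cloud N X) {d η r a : ℝ} (hd : 0 < d) (hη : 0 < η)
    (hr : |r| ≤ t * η) (hro : |r| ≤ o)
    (h0 : ∫ y, M.score T t (fun x => f x - r * 1) c y ∂p = 0)
    (h1 : 2 * d ≤ ∫ y, M.score T t (fun _ => 1) c y ∂p)
    (ha1 : a ≤ N * d ^ 2 / (2 * (b ^ (T + 1) * 1) ^ 2))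
    (ha2 : a ≤ N * (η * d) ^ 2 / (2 * (b ^ (T + 1) * (2 * o)) ^ 2))
    {U : Cloud N X → ℕ → Cloud N X} (hU : ∀ y, U y t = y) (hU' : ∀ y, ∀ u < t, U y u = c u) :
    (Measure.pi fun _ : Fin N => p) {y | U y ∉ M.goodEvent N T t b d ((t + 1) * η) f}
      ≤ ENNReal.ofReal (4 * Real.exp (-a)) := by
  have hb0 : (0 : ℝ) < b := by exact_mod_cast zero_lt_one.trans_le hb1
  have hbound : ∀ {f : (ℕ → X) → ℝ} {m : ℝ}, 0 < m → (∀ x, |f x| ≤ m) →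
      ∀ᵐ y ∂p, |M.score T t f c y| ≤ b ^ (T + 1) * m := fun hm hf =>
    hp.mono fun y hy => M.abs_score_le hb ht hb1 hm.le hf c hy
  have hmeas : ∀ {f : (ℕ → X) → ℝ}, Measurable f → Measurable (M.score T t f c) := fun hf =>
    M.measurable_score hf T t measurable_const measurable_id
  have hfr : ∀ x, |f x - r * 1| ≤ 2 * o := fun x =>
    (abs_sub _ _).trans (by rw [mul_one]; linarith [hf x])
  have H1 := pi_abs_sampleMean_sub_ge_le p N (hmeas (f := fun _ => 1) measurable_const)
    (by positivity) (hbound one_pos (by simp)) hd.le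
  have H2 := pi_abs_sampleMean_sub_ge_le p N
    (hmeas (f := fun x => f x - r * 1) (hfm.sub measurable_const))
    (by positivity) (hbound (by positivity) hfr) (mul_pos hη hd).le
  have H0 : (Measure.pi fun _ : Fin N => p) {y | ¬∀ l, (y l).2 ≤ b} = 0 := by
    rw [← ae_iff, ae_all_iff]
    exact fun l => (Measure.tendsto_eval_ae_ae (μ := fun _ : Fin N => p) (i := l)).eventually hp
  -- Failure requires an oversized weight, a deviation d of the denominator, or a deviation η d of
  -- the centred numerator.
  have hsub : {y | U y ∉ M.goodEvent N T t b d ((t + 1) * η) f} ⊆ ({y | ¬∀ l, (y l).2 ≤ b} ∪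
      {y | d ≤ |(N : ℝ)⁻¹ * ∑ l, M.score T t (fun _ => 1) c (y l) -
        ∫ y, M.score T t (fun _ => 1) c y ∂p|}) ∪
      {y | η * d ≤ |(N : ℝ)⁻¹ * ∑ l, M.score T t (fun x => f x - r * 1) c (y l) -
        ∫ y, M.score T t (fun x => f x - r * 1) c y ∂p|} := by
    intro y hy
    contrapose! hy
    simp only [Set.mem_union, Set.mem_ofPred_eq, not_or, not_not, not_le] at hy ⊢
    obtain ⟨⟨hy0, hy1⟩, hy2⟩ := hy
    have e1 := M.average_of_eq (f := fun _ => 1) (T := T) (hU' y)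
    have e2 := M.average_of_eq (f := f) (T := T) (hU' y)
    have e3 := M.average_of_eq (f := fun x => f x - r * 1) (T := T) (hU' y)
    rw [M.average_sub_const_mul hb ht (f' := fun _ => 1) hfm measurable_const
      (m := o + 1) (fun x => (hf x).trans (by linarith)) (fun x => by rw [abs_one]; linarith)] at e3
    rw [hU] at e1 e2 e3
    rw [← e1] at hy1
    rw [← e3, h0, sub_zero] at hy2
    -- The mean is at least 2d and the deviation is below d.
    have hD : d ≤ M.average T t (fun _ => 1) (U y) := by
      linarith [(abs_lt.1 hy1).1]
    refine ⟨fun l => by rw [hU]; exact not_lt.1 fun h => hy0 ⟨l, h⟩, hD, ?_⟩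
    -- The old quotient contributes tη and the new deviation less than η, both relative to the
    -- denominator.
    have h3 : |M.average T t f (U y)| ≤
        |M.average T t f (U y) - r * M.average T t (fun _ => 1) (U y)| +
          |r| * M.average T t (fun _ => 1) (U y) := by
      rw [← abs_of_nonneg (hd.le.trans hD), ← abs_mul, abs_of_nonneg (hd.le.trans hD)]
      linarith [abs_sub_abs_le_abs_sub (M.average T t f (U y))
        (r * M.average T t (fun _ => 1) (U y))]
    have h4 : |r| * M.average T t (fun _ => 1) (U y) ≤ t * η * M.average T t (fun _ => 1) (U y) :=
      mul_le_mul_of_nonneg_right hr (hd.le.trans hD)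
    have h5 : η * d ≤ η * M.average T t (fun _ => 1) (U y) := by gcongr
    linarith
  refine (measure_mono hsub).trans ((measure_union_le _ _).trans
    ((add_le_add ((measure_union_le _ _).trans (add_le_add H0.le H1)) H2).trans ?_))
  rw [zero_add, ← ENNReal.ofReal_add (by positivity) (by positivity)]
  refine ENNReal.ofReal_le_ofReal ?_
  have e1 := Real.exp_le_exp.2 (neg_le_neg ha1)
  have e2 := Real.exp_le_exp.2 (neg_le_neg ha2)
  linarith

end StateSpaceModel

namespace Proposal

variable {M : StateSpaceModel X} (A : Proposal M) {N : ℕ}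

/-- Each time step adds one failure probability and one η to the allowed quotient. The levels d t
must shrink because the denominator is divided by Θ ≤ b² and then may lose half of its mean. -/
theorem filterLaw_goodEvent_compl_le [NeZero N] {T : ℕ} {b : ℝ≥0} (hb1 : 1 ≤ b)
    (hb : ∀ t ≤ T, ∀ x, M.g t x ≤ b) (hϑ : ∀ t, 1 ≤ t → t ≤ T → ∀ x, A.ϑ t x ≤ b)
    (hw0 : ∀ᵐ x ∂A.ρ₀, A.weight₀ x ≤ b) (hw : ∀ t, 1 ≤ t → t ≤ T → ∀ x x', A.weight t x x' ≤ b)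
    {f : (ℕ → X) → ℝ} (hfm : Measurable f) {o : ℝ} (ho : 0 < o) (hf : ∀ x, |f x| ≤ o)
    (hdep : DependsOn f (Set.Iic T))
    (hf0 : ∫ x, (M.g 0 x : ℝ) * M.lookahead 0 T f (fun _ => x) ∂M.χ = 0)
    {d : ℕ → ℝ} (hd : ∀ t, 0 < d t) (hd0 : 2 * d 0 ≤ (M.evidence T).toReal)
    (hds : ∀ t, 2 * d (t + 1) * b ^ 2 ≤ d t) {η a : ℝ} (hη : 0 < η) (hηo : (T + 1) * η ≤ o)
    (ha1 : ∀ t ≤ T, a ≤ N * d t ^ 2 / (2 * (b ^ (T + 1) * 1) ^ 2))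
    (ha2 : ∀ t ≤ T, a ≤ N * (η * d t) ^ 2 / (2 * (b ^ (T + 1) * (2 * o)) ^ 2))
    (t : ℕ) (ht : t ≤ T) :
    A.filterLaw N t (M.goodEvent N T t b (d t) ((t + 1) * η) f)ᶜ
      ≤ (t + 1) * ENNReal.ofReal (4 * Real.exp (-a)) := by
  have hN : (0 : ℝ) < N := by exact_mod_cast Nat.pos_of_ne_zero (NeZero.ne N)
  induction t with
  | zero =>
    have hc : Measurable fun (y : Cloud N X) (_ : ℕ) => y :=
      measurable_pi_lambda _ fun _ => measurable_id
    obtain ⟨x₀⟩ : Nonempty X := A.ρ₀.nonempty_of_neZero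
    rw [filterLaw, chainLaw, Measure.map_apply hc (M.measurableSet_goodEvent _ _ _ _ _ hfm).compl]
    have := M.pi_goodEvent_compl_le ht hb1 hb A.initParticle (A.initParticle_le hw0) hfm ho hf
      (fun _ _ => (x₀, 0)) (hd 0) hη (r := 0) (by simp) (by simpa using ho.le)
      (by simpa [A.integral_score_zero hfm] using hf0)
      (by rwa [A.integral_score_zero measurable_const, ← M.toReal_evidence hb])
      (ha1 0 ht) (ha2 0 ht) (U := fun y _ => y) (fun _ => rfl) (fun _ u hu => by omega)
    simp only [Nat.cast_zero, zero_add, one_mul] at this ⊢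
    exact this
  | succ t ih =>
    have ht' : t < T := ht
    have hG := M.measurableSet_goodEvent (N := N) T t b (d t) ((t + 1) * η) hfm
    have hE := (M.measurableSet_goodEvent (N := N) T (t + 1) b (d (t + 1))
      ((((t + 1 : ℕ) : ℝ) + 1) * η) hfm).compl
    refine (chainLaw_succ_le_add (b := ENNReal.ofReal (4 * Real.exp (-a))) _ _ t hG hE (ih ht'.le)
      fun c hc => ?_).trans_eq (by push_cast; ring)
    obtain ⟨hcw, hcd, hcf⟩ := hc
    set D := M.average T t (fun _ => 1) c with hD
    have hDpos : 0 < D := (hd t).trans_le hcd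
    set r := M.average T t f c / D with hr
    have hrlt : |r| < (t + 1) * η := by
      rw [hr, abs_div, abs_of_pos hDpos, div_lt_iff₀ hDpos]
      exact hcf
    -- The accumulated drift never exceeds o, which keeps f - r bounded by 2o at every step.
    have hro : |r| ≤ o := by
      refine hrlt.le.trans (le_trans ?_ hηo)
      have : (t : ℝ) + 1 ≤ T + 1 := by exact_mod_cast Nat.succ_le_succ ht'.le
      gcongr
    have hfr : ∀ x, |f x - r * 1| ≤ 2 * o := fun x =>
      (abs_sub _ _).trans (by rw [mul_one]; linarith [hf x])
    have hw' := hw (t + 1) (by omega) ht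
    set Θ := (N : ℝ)⁻¹ * ∑ l, ((c t l).2 : ℝ) * A.ϑ (t + 1) (c t l).1 with hΘ
    have hΘb : Θ ≤ b ^ 2 := by
      have : ∑ l, ((c t l).2 : ℝ) * A.ϑ (t + 1) (c t l).1 ≤ ∑ l : Fin N, (b : ℝ) ^ 2 := by
        refine Finset.sum_le_sum fun l _ => ?_
        rw [sq]
        exact_mod_cast mul_le_mul' (hcw l) (hϑ (t + 1) (by omega) ht _)
      rw [Finset.sum_const, Finset.card_univ, Fintype.card_fin, nsmul_eq_mul] at this
      rw [hΘ, inv_mul_le_iff₀ hN]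
      exact this
    have hΘ0 : 0 ≤ Θ := by positivity
    have S1 := A.adjust_mul_integral_score ht' hb hb1 hw' (f := fun _ => 1) measurable_const
      (m := 1) (by simp) (fun _ _ _ => rfl) c
    have S2 := A.adjust_mul_integral_score ht' hb hb1 hw' (f := fun x => f x - r * 1)
      (hfm.sub measurable_const) hfr (fun x y h => by dsimp only; rw [hdep h]) c
    -- By the choice of r the average of f - r at time t is zero, hence so is Θ times its next
    -- conditional mean.
    rw [M.average_sub_const_mul hb ht'.le (f' := fun _ => 1) hfm measurable_const
      (m := o + 1) (fun x => (hf x).trans (by linarith)) (fun x => by rw [abs_one]; linarith),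
      ← hD, hr, div_mul_cancel₀ _ hDpos.ne', sub_self, ← hr] at S2
    rw [← hD] at S1
    rw [← hΘ] at S1 S2
    -- Θ divides the positive number D, so the all-zero ancestor weights are excluded.
    have hΘne : Θ ≠ 0 := fun h => by rw [h, zero_mul] at S1; exact hDpos.ne S1
    have I2 := (mul_eq_zero.1 S2).resolve_left hΘne
    -- The new mean is D / Θ, with D ≥ d t and Θ ≤ b².
    have I1 : 2 * d (t + 1) ≤
        ∫ y, M.score T (t + 1) (fun _ => 1) c y ∂A.newParticle N (t + 1) (c t) := by
      by_contra! hlt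
      have h1 : Θ * ∫ y, M.score T (t + 1) (fun _ => 1) c y ∂A.newParticle N (t + 1) (c t)
          < Θ * (2 * d (t + 1)) := mul_lt_mul_of_pos_left hlt (lt_of_le_of_ne hΘ0 hΘne.symm)
      have h2 : Θ * (2 * d (t + 1)) ≤ b ^ 2 * (2 * d (t + 1)) :=
        mul_le_mul_of_nonneg_right hΘb (by linarith [hd (t + 1)])
      linarith [hds t]
    exact M.pi_goodEvent_compl_le ht hb1 hb (A.newParticle N (t + 1) (c t))
      (A.newParticle_le _ hw' _) hfm ho hf c (hd (t + 1)) hη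
      (by push_cast; exact hrlt.le) hro I2 I1 (ha1 _ ht) (ha2 _ ht)
      (U := fun y => Function.update c (t + 1) y) (fun y => by simp)
      (fun y u hu => Function.update_of_ne hu.ne _ _)

end Proposal

/-! ### FFBSm as a quotient of averages -/

namespace StateSpaceModel

variable (M : StateSpaceModel X) {N : ℕ}

/-- Averaging over coordinates that f ignores does nothing, since backward probabilities sum to one;
this stops the backward recursion at time s. -/
theorem retro_of_dependsOn [NeZero N] (c : ℕ → Cloud N X) {f : (ℕ → X) → ℝ} {s : ℕ}
    (hf : DependsOn f (Set.Ici s)) (t : ℕ) (ht : t ≤ s) : ∀ x, M.retro c t f x = f x := by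
  induction t with
  | zero => exact fun _ => rfl
  | succ t ih =>
    intro x
    have : ∀ y, f (Function.update x t y) = f x := fun y => hf fun u hu => by
      rw [Function.update_of_ne]
      simp only [Set.mem_Ici] at hu
      omega
    simp only [retro, ih (by omega), this, ← Finset.sum_mul]
    rw [sum_coe_normalize, one_mul]

/-- The path `x` with its coordinates `s, …, s + n - 1` replaced by the particles of indices `i`. -/
def splice {X : Type*} {N : ℕ} (c : ℕ → Cloud N X) (s n : ℕ) (i : Fin n → Fin N) (x : ℕ → X) :
    ℕ → X := fun u => if h : s ≤ u ∧ u < s + n then (c u (i ⟨u - s, by omega⟩)).1 else x u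

theorem splice_snoc {X : Type*} {N : ℕ} (c : ℕ → Cloud N X) (s n : ℕ) (i : Fin n → Fin N)
    (j : Fin N) (x : ℕ → X) :
    splice c s (n + 1) (Fin.snoc (α := fun _ => Fin N) i j) x =
      splice c s n i (Function.update x (s + n) (c (s + n) j).1) := by
  funext u
  unfold splice
  rcases lt_trichotomy u (s + n) with h | rfl | h
  · by_cases hs : s ≤ u
    · have h1 : u - s < n := by omega
      simp [hs, h, h1, Fin.snoc, show u < s + (n + 1) by omega]
    · simp [hs, Function.update_of_ne h.ne]
  · simp [Fin.snoc]
  · simp [h.not_gt, show ¬u < s + (n + 1) by omega, Function.update_of_ne h.ne']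

/-- Expanding the recursion step by step yields a sum over index paths. The index j enters because
the weights of the estimator see the particle at time s + n through its index, whereas `retro` sees
only its position. -/
theorem retro_eq_sum [NeZero N] (c : ℕ → Cloud N X) {f : (ℕ → X) → ℝ} {s : ℕ}
    (hf : DependsOn f (Set.Ici s)) (n : ℕ) : ∀ (x : ℕ → X) (j : Fin N),
    x (s + n) = (c (s + n) j).1 → M.retro c (s + n) f x =
      ∑ i : Fin n → Fin N, (∏ k : Fin n, (M.backward c (s + k)
        (Fin.snoc (α := fun _ => Fin N) i j k.succ)
        (Fin.snoc (α := fun _ => Fin N) i j k.castSucc) : ℝ)) * f (splice c s n i x) := by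
  induction n with
  | zero =>
    intro x j _
    rw [Nat.add_zero, M.retro_of_dependsOn c hf s le_rfl]
    have : ∀ i, splice c s 0 i x = x := fun i => by
      funext u
      simp [splice, show ¬(s ≤ u ∧ u < s) by omega]
    simp [this]
  | succ n ih =>
    intro x j hx
    rw [← (Fin.snocEquiv fun _ => Fin N).sum_comp, Fintype.sum_prod_type, ← Nat.add_assoc, retro]
    refine Finset.sum_congr rfl fun j' _ => ?_
    rw [ih _ j' (by simp), Finset.mul_sum]
    refine Finset.sum_congr rfl fun i _ => ?_
    rw [Fin.prod_univ_castSucc, show (Fin.snocEquiv fun _ => Fin N) (j', i) =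
      Fin.snoc (α := fun _ => Fin N) i j' from rfl]
    simp only [splice_snoc, Fin.succ_last, Fin.snoc_last, Fin.snoc_castSucc,
      Fin.succ_castSucc, Fin.val_castSucc, Fin.val_last]
    have hx' : x (s + n + 1) = (c (s + n + 1) j).1 := hx
    rw [hx', backward]
    ring

theorem ffbsm_eq_sum_retro [NeZero N] {s T : ℕ} (hsT : s ≤ T) (h : (Fin (T - s + 1) → X) → ℝ)
    (c : ℕ → Cloud N X) : M.ffbsm s T h c = ∑ j, (normalize (fun l => (c T l).2) j : ℝ) *
      M.retro c T (fun x => h (segment s T x)) fun _ => (c T j).1 := by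
  have hdep : DependsOn (fun x : ℕ → X => h (segment s T x)) (Set.Ici s) := fun x y hxy => by
    dsimp only
    congr 1
    funext k
    exact hxy _ (by simp only [Set.mem_Ici]; omega)
  have hT : s + (T - s) = T := by omega
  rw [ffbsm, ← (Fin.snocEquiv fun _ => Fin N).sum_comp, Fintype.sum_prod_type]
  refine Finset.sum_congr rfl fun j _ => ?_
  have := M.retro_eq_sum c hdep (T - s) (fun _ => (c T j).1) j (by rw [hT])
  rw [hT] at this
  rw [this, Finset.mul_sum]
  refine Finset.sum_congr rfl fun i _ => ?_
  have hp : segment s T (splice c s (T - s) i fun _ => (c T j).1) =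
      particlePath s T c (Fin.snoc (α := fun _ => Fin N) i j) := by
    funext k
    refine Fin.lastCases ?_ (fun k => ?_) k
    · simp [segment, splice, particlePath, hT]
    · simp [segment, splice, particlePath]
  rw [hp, show (Fin.snocEquiv fun _ => Fin N) (j, i) = Fin.snoc (α := fun _ => Fin N) i j from rfl]
  simp only [indexProb, Fin.snoc_last, NNReal.coe_mul, NNReal.coe_prod]
  ring

/-- At time T no future remains, so the average of 1 is the mean weight, which clears the
normalisation of the final weights. -/
theorem ffbsm_mul_average [NeZero N] {s T : ℕ} (hsT : s ≤ T) (h : (Fin (T - s + 1) → X) → ℝ)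
    (c : ℕ → Cloud N X) : M.average T T (fun _ => 1) c * M.ffbsm s T h c =
      M.average T T (fun x => h (segment s T x)) c := by
  have hn : ∀ j, (∑ l, ((c T l).2 : ℝ)) * (normalize (fun l => (c T l).2) j : ℝ) = (c T j).2 :=
    fun j => by exact_mod_cast sum_mul_normalize (fun l => (c T l).2) j
  simp only [average, score, Nat.sub_self, lookahead, M.retro_one, mul_one]
  rw [M.ffbsm_eq_sum_retro hsT, mul_assoc, Finset.mul_sum]
  simp only [← mul_assoc, hn]

theorem measurable_ffbsm {s T : ℕ} {h : (Fin (T - s + 1) → X) → ℝ} (hm : Measurable h) :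
    Measurable fun c : ℕ → Cloud N X => M.ffbsm s T h c := by
  refine Finset.measurable_sum _ fun i _ =>
    (M.measurable_indexProb s T i).coe_nnreal_real.mul (hm.comp ?_)
  exact measurable_pi_lambda _ fun k =>
    ((measurable_pi_apply (i k)).comp (measurable_pi_apply (s + k))).fst

theorem ffbsm_sub_const [NeZero N] {s T : ℕ} (h : (Fin (T - s + 1) → X) → ℝ) (r : ℝ)
    (c : ℕ → Cloud N X) : M.ffbsm s T (fun x => h x - r) c = M.ffbsm s T h c - r := by
  have : ∑ i, (M.indexProb s T c i : ℝ) = 1 := by exact_mod_cast M.sum_indexProb s T c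
  simp only [ffbsm, mul_sub, Finset.sum_sub_distrib, ← Finset.sum_mul, this, one_mul]

theorem integral_indexKernel [NeZero N] {s T : ℕ} (c : ℕ → Cloud N X)
    (v : (Fin (T - s + 1) → Fin N) → ℝ) :
    ∫ i, v i ∂M.indexKernel N s T c = ∑ i, (M.indexProb s T c i : ℝ) * v i := by
  rw [indexKernel, integral_mixture _ _ _ _ fun i => by
    simp only [Kernel.const_apply]; exact integrable_dirac (by finiteness)]
  simp

end StateSpaceModel

/-! ### Oscillation bounds, the FFBSi sampling error and the FFBSm deviation inequality -/

theorem abs_sub_le_toReal_osc {γ : Type*} {h : γ → ℝ} (ho : osc h ≠ ∞) (x y : γ) :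
    |h x - h y| ≤ (osc h).toReal :=
  (ENNReal.ofReal_le_iff_le_toReal ho).1
    (le_iSup₂ (f := fun x x' => ENNReal.ofReal |h x - h x'|) x y)

theorem abs_sub_integral_le {α : Type*} [MeasurableSpace α] {μ : Measure α}
    [IsProbabilityMeasure μ] {h : α → ℝ} (hm : Measurable h) {o : ℝ}
    (ho : ∀ x y, |h x - h y| ≤ o) (x : α) : |h x - ∫ y, h y ∂μ| ≤ o := by
  have hi : Integrable h μ := integrable_of_abs_le hm (m := |h x| + o) fun y => by
    have := abs_sub_abs_le_abs_sub (h y) (h x)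
    linarith [ho y x]
  have := norm_integral_le_of_norm_le_const (μ := μ) (f := fun y => h x - h y) (.of_forall (ho x))
  rw [integral_sub (integrable_const _) hi] at this
  simpa using this

theorem ofReal_mul_exp_le_hoeffdingBound {γ : Type*} {h : γ → ℝ} (ho : osc h ≠ ∞)
    (ho' : 0 < (osc h).toReal) {B C : ℝ} (hB : 0 ≤ B) {N : ℕ} {ε : ℝ} (hC : 0 ≤ C) :
    ENNReal.ofReal (B * Real.exp (-(C * N * ε ^ 2 / (osc h).toReal ^ 2))) ≤
      hoeffdingBound B C N ε h := by
  have : ENNReal.ofReal (C * N * ε ^ 2) / osc h ^ 2 =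
      ENNReal.ofReal (C * N * ε ^ 2 / (osc h).toReal ^ 2) := by
    rw [ENNReal.ofReal_div_of_pos (by positivity), ENNReal.ofReal_pow ho'.le,
      ENNReal.ofReal_toReal ho]
  rw [hoeffdingBound, this, EReal.coe_ennreal_ofReal, max_eq_left (by positivity),
    ← EReal.coe_neg, EReal.exp_coe, ENNReal.ofReal_mul hB]

theorem measurable_particlePath {N s T : ℕ} (i : Fin (T - s + 1) → Fin N) :
    Measurable fun c : ℕ → Cloud N X => particlePath s T c i :=
  measurable_pi_lambda _ fun k =>
    ((measurable_pi_apply (i k)).comp (measurable_pi_apply (s + k))).fst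

theorem measurable_ffbsi {N s T : ℕ} {h : (Fin (T - s + 1) → X) → ℝ} (hm : Measurable h) :
    Measurable fun z : (ℕ → Cloud N X) × (Fin N → Fin (T - s + 1) → Fin N) =>
      ffbsi s T h z.1 z.2 :=
  measurable_from_prod_countable_left fun J =>
    measurable_const.mul (Finset.measurable_sum _ fun l _ => hm.comp (measurable_particlePath (J l)))

theorem abs_ffbsi_sub_le {X : Type*} {N s T : ℕ} [NeZero N] {h : (Fin (T - s + 1) → X) → ℝ}
    {r o : ℝ} (ho : ∀ x, |h x - r| ≤ o) (c : ℕ → Cloud N X)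
    (J : Fin N → Fin (T - s + 1) → Fin N) : |ffbsi s T h c J - r| ≤ o := by
  have hN : (N : ℝ) ≠ 0 := by exact_mod_cast NeZero.ne N
  have h1 : ∑ _l : Fin N, ((N : ℝ≥0)⁻¹) = 1 := by
    have hN : (N : ℝ≥0) ≠ 0 := by exact_mod_cast NeZero.ne N
    simp [hN]
  have h2 := abs_sum_mul_le h1 (v := fun l => h (particlePath s T c (J l)) - r) fun l => ho _
  rw [← Finset.mul_sum, Finset.sum_sub_distrib] at h2
  simpa [ffbsi, mul_sub, hN] using h2

theorem StateSpaceModel.abs_ffbsm_sub_le (M : StateSpaceModel X) {N s T : ℕ} [NeZero N]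
    {h : (Fin (T - s + 1) → X) → ℝ} {r o : ℝ} (ho : ∀ x, |h x - r| ≤ o) (c : ℕ → Cloud N X) :
    |M.ffbsm s T h c - r| ≤ o := by
  rw [← M.ffbsm_sub_const]
  exact abs_sum_mul_le (M.sum_indexProb s T c) fun i => ho _

/-- Conditional deviations of the FFBSi estimator from the FFBSm estimator. -/
theorem StateSpaceModel.iid_indexKernel_le (M : StateSpaceModel X) {N s T : ℕ} [NeZero N]
    {h : (Fin (T - s + 1) → X) → ℝ} {r o : ℝ} (ho : 0 < o) (hr : ∀ x, |h x - r| ≤ o)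
    {δ : ℝ} (hδ : 0 ≤ δ) (c : ℕ → Cloud N X) :
    iid (M.indexKernel N s T) N c {J | δ ≤ |ffbsi s T h c J - M.ffbsm s T h c|} ≤
      ENNReal.ofReal (2 * Real.exp (-(N * δ ^ 2 / (2 * o ^ 2)))) := by
  have hN : (N : ℝ) ≠ 0 := by exact_mod_cast NeZero.ne N
  have := pi_abs_sampleMean_sub_ge_le (M.indexKernel N s T c) N
    (ψ := fun i => h (particlePath s T c i) - r) (measurable_of_countable _) ho
    (.of_forall fun i => hr _) hδ
  rw [M.integral_indexKernel] at this
  have h1 : ∑ i, (M.indexProb s T c i : ℝ) * (h (particlePath s T c i) - r) =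
    M.ffbsm s T h c - r := (M.ffbsm_sub_const h r c)
  have h2 : ∀ J : Fin N → Fin (T - s + 1) → Fin N,
      (N : ℝ)⁻¹ * ∑ l, (h (particlePath s T c (J l)) - r) = ffbsi s T h c J - r := fun J => by
    simp [ffbsi, mul_sub, Finset.sum_sub_distrib, hN]
  simp only [h1, h2, sub_sub_sub_cancel_right] at this
  exact this

/-- Exponential deviation inequality for the FFBSm estimator. -/
theorem Proposal.exists_filterLaw_ffbsm_le {M : StateSpaceModel X} (A : Proposal M) {s T : ℕ}
    (hsT : s ≤ T) (hpos : 0 < M.evidence T) (hA1 : BoundedLikelihood M T)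
    (hA2 : BoundedWeights A T) : ∃ κ : ℝ, 0 < κ ∧ ∀ (N : ℕ) [NeZero N] (ε o : ℝ), 0 < ε → ε ≤ o →
      ∀ h : (Fin (T - s + 1) → X) → ℝ, Measurable h → (∀ x y, |h x - h y| ≤ o) →
        A.filterLaw N T {c | ε ≤ |M.ffbsm s T h c - ∫ x, h x ∂M.smoothing s T|} ≤
          ENNReal.ofReal (4 * (T + 1) * Real.exp (-(κ * N * ε ^ 2 / o ^ 2))) := by
  obtain ⟨b₁, hb₁⟩ := hA1
  obtain ⟨b₂, hϑ, hw0, hw⟩ := hA2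
  -- One bound for everything, taken at least 1 so that its powers increase.
  set b : ℝ≥0 := max 1 (max b₁ b₂) with hbdef
  have hb1 : 1 ≤ b := le_max_left _ _
  have hbb₁ : b₁ ≤ b := (le_max_left _ _).trans (le_max_right _ _)
  have hbb₂ : b₂ ≤ b := (le_max_right _ _).trans (le_max_right _ _)
  have hbb₂' : (b₂ : ℝ≥0∞) ≤ b := by exact_mod_cast hbb₂
  have hb : ∀ t ≤ T, ∀ x, M.g t x ≤ b := fun t ht x => (hb₁ t ht x).trans hbb₁
  have hbR : (1 : ℝ) ≤ b := by exact_mod_cast hb1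
  have hZ : 0 < (M.evidence T).toReal := ENNReal.toReal_pos hpos.ne' (M.evidence_ne_top hb)
  set Z := (M.evidence T).toReal with hZdef
  -- Start at half the evidence and lose a factor 2b² per step: b² for Θ, 2 for the deviation.
  set d : ℕ → ℝ := fun t => Z / 2 / (2 * (b : ℝ) ^ 2) ^ t with hd
  have hdpos : ∀ t, 0 < d t := fun t => by positivity
  have hdT : ∀ t ≤ T, d T ≤ d t := fun t ht => by
    refine div_le_div_of_nonneg_left (by positivity) (by positivity) (pow_le_pow_right₀ ?_ ht)
    nlinarith
  set K : ℝ := (b : ℝ) ^ (T + 1) with hK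
  have hKpos : 0 < K := by positivity
  -- This is the Hoeffding exponent for deviation η d T and score bound 2Ko, with η = ε/(T+1); the
  -- level d T is the smallest.
  refine ⟨d T ^ 2 / (8 * K ^ 2 * (T + 1) ^ 2), by have := hdpos T; positivity, ?_⟩
  intro N _ ε o hε hεo h hm ho
  have hopos : 0 < o := hε.trans_le hεo
  have := M.isProbabilityMeasure_smoothing hb hpos s
  set φ := ∫ x, h x ∂M.smoothing s T with hφ
  have hφo : ∀ x, |h x - φ| ≤ o := abs_sub_integral_le hm ho
  have hφ0 : ∫ x, (h x - φ) ∂M.smoothing s T = 0 := by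
    have hi : Integrable h (M.smoothing s T) :=
      integrable_of_abs_le hm (m := |φ| + o) fun y => by
        have := abs_sub_abs_le_abs_sub (h y) φ
        linarith [hφo y]
    rw [integral_sub hi (integrable_const _)]
    simp [hφ]
  set f : (ℕ → X) → ℝ := fun x => h (segment s T x) - φ with hf
  have hfm : Measurable f := (hm.comp (measurable_segment s T)).sub_const φ
  have hf0 : ∫ x, (M.g 0 x : ℝ) * M.lookahead 0 T f (fun _ => x) ∂M.χ = 0 := by
    rw [hf, ← M.evidence_mul_integral_smoothing hb hpos s (hm.sub_const φ) hφo, hφ0, mul_zero]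
  have hT : (0 : ℝ) < T + 1 := by positivity
  have hT1 : (1 : ℝ) ≤ T + 1 := by linarith [(Nat.cast_nonneg T : (0 : ℝ) ≤ T)]
  have key := A.filterLaw_goodEvent_compl_le (N := N) hb1 hb
    (fun t h1 h2 x => (hϑ t h1 h2 x).trans hbb₂) (hw0.mono fun x hx => hx.trans hbb₂')
    (fun t h1 h2 x x' => (hw t h1 h2 x x').trans hbb₂') hfm hopos (fun x => hφo _)
    (dependsOn_segment hsT fun x => h x - φ) hf0 (d := d) hdpos
    (by simp [hd]; linarith)
    (fun t => by
      simp only [hd, pow_succ]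
      refine le_of_eq ?_
      field_simp)
    (η := ε / (T + 1)) (a := d T ^ 2 / (8 * K ^ 2 * (T + 1) ^ 2) * N * ε ^ 2 / o ^ 2)
    (by positivity) (by rwa [mul_div_cancel₀ _ hT.ne'])
    -- The denominator exponent carries no ε; it dominates because ε ≤ o.
    (fun t ht => by
      have h1 : d T ^ 2 ≤ d t ^ 2 := pow_le_pow_left₀ (hdpos T).le (hdT t ht) 2
      have h2 : ε ^ 2 / o ^ 2 ≤ 1 := by
        rw [div_le_one (by positivity)]
        exact pow_le_pow_left₀ hε.le hεo 2
      have h3 : (1 : ℝ) ≤ (T + 1) ^ 2 := one_le_pow₀ hT1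
      calc d T ^ 2 / (8 * K ^ 2 * (T + 1) ^ 2) * N * ε ^ 2 / o ^ 2
          = N * d T ^ 2 / (8 * K ^ 2 * (T + 1) ^ 2) * (ε ^ 2 / o ^ 2) := by ring
        _ ≤ N * d T ^ 2 / (8 * K ^ 2 * (T + 1) ^ 2) * 1 := by gcongr
        _ ≤ N * d t ^ 2 / (2 * (K * 1) ^ 2) := by
            rw [mul_one, mul_one]
            refine div_le_div₀ (by positivity) (by gcongr) (by positivity) ?_
            nlinarith [mul_le_mul_of_nonneg_left h3 (sq_nonneg K), sq_nonneg K])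
    (fun t ht => by
      have h1 : d T ^ 2 ≤ d t ^ 2 := pow_le_pow_left₀ (hdpos T).le (hdT t ht) 2
      calc d T ^ 2 / (8 * K ^ 2 * (T + 1) ^ 2) * N * ε ^ 2 / o ^ 2
          ≤ d t ^ 2 / (8 * K ^ 2 * (T + 1) ^ 2) * N * ε ^ 2 / o ^ 2 := by gcongr
        _ = N * (ε / (T + 1) * d t) ^ 2 / (2 * (K * (2 * o)) ^ 2) := by
            field_simp
            ring)
    T le_rfl
  refine (measure_mono fun c hc => ?_).trans (key.trans_eq ?_)
  -- The good event at time T bounds the quotient by (T+1)η = ε, and the quotient is the FFBSm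
  -- error.
  · intro hgood
    obtain ⟨-, hD, hlt⟩ := hgood
    have hDpos := (hdpos T).trans_le hD
    have e : M.average T T f c = M.average T T (fun _ => 1) c * (M.ffbsm s T h c - φ) := by
      rw [← M.ffbsm_sub_const, M.ffbsm_mul_average hsT]
    rw [mul_div_cancel₀ _ hT.ne', e, abs_mul, abs_of_pos hDpos, mul_comm,
      mul_lt_mul_iff_left₀ hDpos] at hlt
    exact not_lt.2 hc hlt
  · rw [show ((T : ℝ≥0∞) + 1) = ENNReal.ofReal (T + 1) by
      rw [ENNReal.ofReal_add (by positivity) zero_le_one]; simp, ← ENNReal.ofReal_mul hT.le]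
    congr 1
    ring

end FFBS

end

/-! ### Both inequalities, uniformly in h -/

theorem mainTheorem2 {X : Type*} [TopologicalSpace X] [PolishSpace X] [MeasurableSpace X]
    [BorelSpace X] (M : FFBS.StateSpaceModel X) (A : FFBS.Proposal M) (s T : ℕ) (hs : 1 ≤ s)
    (hsT : s ≤ T) (hpos : 0 < M.evidence T) (hA1 : FFBS.BoundedLikelihood M T)
    (hA2 : FFBS.BoundedWeights A T) :
    ∃ B C : ℝ, 0 < B ∧ 0 < C ∧
      ∀ (N : ℕ) [NeZero N] (ε : ℝ), 0 < ε →
      ∀ h : (Fin (T - s + 1) → X) → ℝ, Measurable h →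
        A.ffbsLaw N s T {z | ε ≤ |M.ffbsm s T h z.1 - ∫ x, h x ∂M.smoothing s T|}
            ≤ FFBS.hoeffdingBound B C N ε h ∧
        A.ffbsLaw N s T {z | ε ≤ |FFBS.ffbsi s T h z.1 z.2 - ∫ x, h x ∂M.smoothing s T|}
            ≤ FFBS.hoeffdingBound B C N ε h := by
  obtain ⟨κ, hκ, hffbsm⟩ := A.exists_filterLaw_ffbsm_le hsT hpos hA1 hA2
  obtain ⟨b, hb⟩ := hA1
  have := M.isProbabilityMeasure_smoothing hb hpos s
  have hB : (0 : ℝ) < 4 * (T + 1) + 2 := by positivity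
  have hC : 0 < min (κ / 4) (1 / 8) := by positivity
  refine ⟨4 * (T + 1) + 2, min (κ / 4) (1 / 8), hB, hC, fun N _ ε hε h hm => ?_⟩
  set φ := ∫ x, h x ∂M.smoothing s T with hφ
  by_cases ho : FFBS.osc h = ∞
  -- For infinite oscillation the bound is B ≥ 1, which holds for any value of the integral.
  · have h1 : 1 ≤ FFBS.hoeffdingBound (4 * (T + 1) + 2) (min (κ / 4) (1 / 8)) N ε h := by
      rw [FFBS.hoeffdingBound, ho, ENNReal.top_pow two_ne_zero, ENNReal.div_top]
      simp only [EReal.coe_ennreal_zero, neg_zero, EReal.exp_zero, mul_one, ENNReal.one_le_ofReal]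
      linarith [(Nat.cast_nonneg T : (0 : ℝ) ≤ T)]
    exact ⟨prob_le_one.trans h1, prob_le_one.trans h1⟩
  have hosc := FFBS.abs_sub_le_toReal_osc ho
  have hφo : ∀ x, |h x - φ| ≤ (FFBS.osc h).toReal := FFBS.abs_sub_integral_le hm hosc
  set o := (FFBS.osc h).toReal with hodef
  -- Both errors are at most o, so the events are empty when o < ε. This also disposes of constant h
  -- and leaves o > 0.
  rcases lt_or_ge o ε with hlt | hεo
  · have h1 : ∀ c : ℕ → FFBS.Cloud N X, ¬ε ≤ |M.ffbsm s T h c - φ| := fun c =>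
      not_le.2 ((M.abs_ffbsm_sub_le hφo c).trans_lt hlt)
    have h2 : ∀ (c : ℕ → FFBS.Cloud N X) J, ¬ε ≤ |FFBS.ffbsi s T h c J - φ| := fun c J =>
      not_le.2 ((FFBS.abs_ffbsi_sub_le hφo c J).trans_lt hlt)
    simp [h1, h2]
  have hopos : 0 < o := hε.trans_le hεo
  have hexp : ∀ {C' : ℝ}, min (κ / 4) (1 / 8) ≤ C' → Real.exp (-(C' * N * ε ^ 2 / o ^ 2)) ≤
      Real.exp (-(min (κ / 4) (1 / 8) * N * ε ^ 2 / o ^ 2)) := fun hC' => by gcongr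
  have hbound := FFBS.ofReal_mul_exp_le_hoeffdingBound (N := N) (ε := ε) ho hopos hB.le hC.le
  rw [← hodef] at hbound
  set e := Real.exp (-(min (κ / 4) (1 / 8) * N * ε ^ 2 / o ^ 2)) with he
  have hepos : 0 < e := Real.exp_pos _
  have hmeas : Measurable fun c : ℕ → FFBS.Cloud N X => M.ffbsm s T h c := M.measurable_ffbsm hm
  constructor
  · refine le_trans ?_ hbound
    have hS : MeasurableSet {c : ℕ → FFBS.Cloud N X | ε ≤ |M.ffbsm s T h c - φ|} :=
      measurableSet_le measurable_const (continuous_abs.measurable.comp (hmeas.sub_const φ))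
    have h1 := hffbsm N ε o hε hεo h hm hosc
    -- FFBSm depends on the clouds only, so the law of the filter suffices.
    rw [← Measure.fst_compProd (A.filterLaw N T) (FFBS.iid (M.indexKernel N s T) N),
      Measure.fst_apply hS] at h1
    refine h1.trans (ENNReal.ofReal_le_ofReal ?_)
    have := hexp (C' := κ) ((min_le_left _ _).trans (by linarith))
    nlinarith [(Nat.cast_nonneg T : (0 : ℝ) ≤ T)]
  · refine le_trans ?_ hbound
    have hG : MeasurableSet {c : ℕ → FFBS.Cloud N X | |M.ffbsm s T h c - φ| < ε / 2} :=
      measurableSet_lt (continuous_abs.measurable.comp (hmeas.sub_const φ)) measurable_const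
    have hE : MeasurableSet {z : (ℕ → FFBS.Cloud N X) × (Fin N → Fin (T - s + 1) → Fin N) |
        ε ≤ |FFBS.ffbsi s T h z.1 z.2 - φ|} :=
      measurableSet_le measurable_const
        (continuous_abs.measurable.comp ((FFBS.measurable_ffbsi hm).sub_const φ))
    -- Half of ε goes to the FFBSm error and half to the sampling of index paths, which gives the
    -- exponents κ/4 and 1/8 and the prefactors 4(T+1) and 2.
    have h1 := hffbsm N (ε / 2) o (by linarith) (by linarith) h hm hosc
    refine (FFBS.compProd_le_add _ _ hG hE (a := ENNReal.ofReal (4 * (T + 1) * e))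
      (b := ENNReal.ofReal (2 * e)) ?_ fun c hc => ?_).trans ?_
    · have : {c : ℕ → FFBS.Cloud N X | |M.ffbsm s T h c - φ| < ε / 2}ᶜ =
          {c | ε / 2 ≤ |M.ffbsm s T h c - φ|} := by
        ext c
        simp
      rw [this]
      refine h1.trans (ENNReal.ofReal_le_ofReal ?_)
      have := hexp (C' := κ / 4) (min_le_left _ _)
      rw [show κ * N * (ε / 2) ^ 2 / o ^ 2 = κ / 4 * N * ε ^ 2 / o ^ 2 by ring]
      gcongr
    · have h2 := M.iid_indexKernel_le hopos hφo (half_pos hε).le c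
      refine (measure_mono fun J hJ => ?_).trans (h2.trans (ENNReal.ofReal_le_ofReal ?_))
      · have hc' : |M.ffbsm s T h c - φ| < ε / 2 := hc
        have hJ' : ε ≤ |FFBS.ffbsi s T h c J - φ| := hJ
        have := abs_sub_le (FFBS.ffbsi s T h c J) (M.ffbsm s T h c) φ
        simp only [Set.mem_ofPred_eq]
        linarith
      · have := hexp (C' := 1 / 8) (min_le_right _ _)
        rw [show N * (ε / 2) ^ 2 / (2 * o ^ 2) = 1 / 8 * N * ε ^ 2 / o ^ 2 by ring]
        gcongr
    · rw [← ENNReal.ofReal_add (by positivity) (by positivity)]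
      exact ENNReal.ofReal_le_ofReal (by linarith)
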